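/- Let $\mathcal V$ be either the space of smooth loops $\{f\in C^\infty(\mathbb R,\mathbb C): f(t+2)=f(t)\}$ or the space of smooth antiloops $\{f\in C^\infty(\mathbb R,\mathbb C): f(t+2)=-f(t)\}$, with $\langle f,g\rangle_{L^2}=\int_0^2 f\bar g\,dt$, and on $\mathcal V^2$ let $g^{L^2}=\mathrm{Re}\langle\cdot,\cdot\rangle_{L^2}$. For $\Phi=(\Phi_1,\Phi_2)$, $F=(F_1,F_2)\in\mathcal V^2$ let $\Phi^*F$ be the $2\times2$ matrix with entries $(\Phi^*F)_{ij}=\langle F_j,\Phi_i\rangle_{L^2}$; matrices act on rows of functions from the right. Let $$\mathrm{St}_2(\mathcal V)=\{\Phi\in\mathcal V^2:\Phi^*\Phi=\mathrm{Id}\},\qquad T_\Phi\mathrm{St}_2(\mathcal V)=\{F\in\mathcal V^2:\Phi^*F+F^*\Phi=0\},\qquad T^{hor}_\Phi\mathrm{St}_2(\mathcal V)=\{F\in\mathcal V^2:\Phi^*F=0\}.$$ Let $\mathrm{Gr}_2(\mathcal V)=\mathrm{St}_2(\mathcal V)/\mathrm U(2)$ be the space of complex $2$-planes in $\mathcal V$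 with the quotient metric, and $[\Phi]=\mathrm{span}_{\mathbb C}\{\Phi_1,\Phi_2\}$; its tangent vectors are the horizontal vectors $(\Phi,F)$, $F\in T^{hor}_\Phi\mathrm{St}_2(\mathcal V)$, modulo $\mathrm U(2)$. Paths are parameterized by open intervals $I\subset\mathbb R$. A path in $\mathrm{St}_2(\mathcal V)$ is smooth if it is jointly smooth in $(u,t)$; a path in $\mathrm{Gr}_2(\mathcal V)$ is smooth if it has a smooth lift to $\mathrm{St}_2(\mathcal V)$; likewise for variations. A geodesic (of either space) is a smooth path that on every $[a,b]\subset I$ is a critical point of the energy $\frac12\int_a^b\|\partial_u\cdot\|^2du$ under smooth variations with fixed endpoints. 1. A smooth path $\Phi_u$ in $\mathrm{St}_2(\mathcal V)$ is a geodesic for $g^{L^2}$ if and only if $$\frac{\partial^2}{\partial u^2}\Phi_u+\Phi_u\Big(\frac{\partial}{\partial u}\Phi_u\Big)^*\frac{\partial}{\partial u}\Phi_u=0 .$$ 2. Let $\Phi\in\mathrm{St}_2(\mathcal V)$ and $\delta\Phi\in T_\Phi\mathrm{St}_2(\mathcal V)$ (not necessarily of norm $1$). Then $$\Phi_u=(\Phi,\delta\Phi)\,\exp\left(u\begin{pmatrix}\Phi^*\delta\Phi&-\delta\Phi^*\delta\Phi\\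 \mathrm{Id}_{2\times2}&\Phi^*\delta\Phi\end{pmatrix}\right)\mathrm{Id}_{4\times2}\,\exp(-u\,\Phi^*\delta\Phi),\qquad u\in\mathbb R,$$ is a geodesic of $\mathrm{St}_2(\mathcal V)$ with $\Phi_0=\Phi$ and $\frac{\partial}{\partial u}\big|_{u=0}\Phi_u=\delta\Phi$, and every geodesic with these initial data on an open interval $I\ni0$ agrees with it on $I$. 3. Consequently a geodesic on an open interval $I\ni 0$ with initial data $(\Phi,\delta\Phi)$ satisfies $\Phi_u\in\mathrm{St}_2(\mathcal W)$ for all $u\in I$, where $\mathcal W\subset\mathcal V$ is the complex span of the components of $\Phi$ and $\delta\Phi$, and $\dim_{\mathbb C}\mathcal W\le4$. 4. If $\delta\Phi\in T^{hor}_\Phi\mathrm{St}_2(\mathcal V)$, then the geodesic $\Phi_u$ of part 2 is horizontal for all $u$, the path $[\Phi_u]$, $u\in\mathbb R$, is a geodesic of $\mathrm{Gr}_2(\mathcal V)$ whose initial velocity is the tangent vector represented by $(\Phi,\delta\Phi)$, and every geodesic of $\mathrm{Gr}_2(\mathcal V)$ with this initial velocity on an open interval $I\ni0$ agrees with it on $I$.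 Hence the exponential map of $\mathrm{Gr}_2(\mathcal V)$, which sends a tangent vector $\xi$ to the value at time $1$ of a geodesic with initial velocity $\xi$ defined on an open interval containing $[0,1]$, is a well-defined map on the whole tangent bundle. -/

import Mathlib

open scoped ContDiff

noncomputable section

namespace FramedLoop

/-! ### The function spaces

The circle is `ℝ / 2ℤ`, so a smooth loop is a smooth `2`-periodic function on the line, and a smoothly
antiperiodic path on `[0, 2]` is the restriction of exactly one smooth `f` with `f (t + 2) = - f t`. -/

/-- The space of smooth loops in `ℂ`. -/
def loopSpace : Submodule ℂ (ℝ → ℂ) where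
  carrier := {f | ContDiff ℝ ∞ f ∧ ∀ t, f (t + 2) = f t}
  add_mem' := by
    rintro f g ⟨hf, hf2⟩ ⟨hg, hg2⟩
    exact ⟨hf.add hg, fun t => by simp [hf2 t, hg2 t]⟩
  zero_mem' := ⟨contDiff_const, fun _ => rfl⟩
  smul_mem' := by
    rintro c f ⟨hf, hf2⟩
    exact ⟨contDiff_const.smul hf, fun t => by simp [hf2 t]⟩

/-- The space of smooth antiloops in `ℂ`. -/
def antiloopSpace : Submodule ℂ (ℝ → ℂ) where
  carrier := {f | ContDiff ℝ ∞ f ∧ ∀ t, f (t + 2) = - f t}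
  add_mem' := by
    rintro f g ⟨hf, hf2⟩ ⟨hg, hg2⟩
    exact ⟨hf.add hg, fun t => by simp only [Pi.add_apply, hf2 t, hg2 t]; ring⟩
  zero_mem' := ⟨contDiff_const, fun _ => by simp⟩
  smul_mem' := by
    rintro c f ⟨hf, hf2⟩
    exact ⟨contDiff_const.smul hf, fun t => by simp [hf2 t]⟩

/-- The Hermitian `L²` product `∫₀² f ḡ dt`, linear in the first argument. -/
def l2Inner (f g : ℝ → ℂ) : ℂ := ∫ t in (0 : ℝ)..2, f t * starRingEnd ℂ (g t)

/-- A pair `Φ = (φ, ψ) = (Φ 0, Φ 1)` of functions. -/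
abbrev Pair : Type := Fin 2 → ℝ → ℂ

/-- The Riemannian metric `Re ⟨F, G⟩` on pairs of functions. -/
def gL2 (F G : Pair) : ℝ := (∑ i, l2Inner (F i) (G i)).re

/-- Right multiplication of a row of functions by a matrix: `(Φ A)_j = ∑ i, Φ_i A_{ij}`. -/
def rmul {m n : Type} [Fintype m] (Φ : m → ℝ → ℂ) (A : Matrix m n ℂ) : n → ℝ → ℂ :=
  fun j t => ∑ i, Φ i t * A i j

/-- The formal adjoint: `adj Φ F` is the matrix `Φ* F`, with entries `⟨F_j, Φ_i⟩`. -/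
def adj (Φ F : Pair) : Matrix (Fin 2) (Fin 2) ℂ := Matrix.of fun i j => l2Inner (F j) (Φ i)

/-! ### The Stiefel manifold -/

/-- The `L²`-orthonormal `2`-frames in a space `V` of functions. -/
def stiefel (V : Submodule ℂ (ℝ → ℂ)) : Set Pair :=
  {Φ | (∀ i, Φ i ∈ V) ∧ l2Inner (Φ 0) (Φ 0) = 1 ∧ l2Inner (Φ 1) (Φ 1) = 1 ∧
    l2Inner (Φ 0) (Φ 1) = 0}

/-- The tangent space of the Stiefel manifold at `Φ`. -/
def stiefelTangent (V : Submodule ℂ (ℝ → ℂ)) (Φ : Pair) : Set Pair :=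
  {F | (∀ i, F i ∈ V) ∧ (l2Inner (Φ 0) (F 0)).re = 0 ∧ (l2Inner (Φ 1) (F 1)).re = 0 ∧
    l2Inner (Φ 0) (F 1) + l2Inner (F 0) (Φ 1) = 0}

/-- The tangent vectors at `Φ` that are horizontal for the action of `U(2)`. -/
def horizontal (V : Submodule ℂ (ℝ → ℂ)) (Φ : Pair) : Set Pair :=
  {F | (∀ i, F i ∈ V) ∧ ∀ i j, l2Inner (Φ i) (F j) = 0}

/-- The derivative of a path of pairs in its path parameter. -/
def velocity (Φ : ℝ → Pair) (u : ℝ) : Pair := fun i t => deriv (fun v => Φ v i t) u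

/-- The second derivative of a path of pairs in its path parameter. -/
def acceleration (Φ : ℝ → Pair) : ℝ → Pair := velocity (velocity Φ)

/-- `Φ` restricts to a smooth path `I → St₂(V)`, for `I` open. A path in a space of smooth functions is
smooth exactly if it is jointly smooth in the path parameter and the function variable. -/
def IsSmoothPath (V : Submodule ℂ (ℝ → ℂ)) (I : Set ℝ) (Φ : ℝ → Pair) : Prop :=
  (∀ i, ContDiffOn ℝ ∞ (fun p : ℝ × ℝ => Φ p.1 i p.2) (I ×ˢ Set.univ)) ∧
    ∀ u ∈ I, Φ u ∈ stiefel V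

/-- `Ψ` restricts to a smooth one-parameter family `(s, u) ↦ Ψ s u`, `s ∈ ℝ`, `u ∈ I`, in `St₂(V)`. -/
def IsSmoothFamily (V : Submodule ℂ (ℝ → ℂ)) (I : Set ℝ) (Ψ : ℝ → ℝ → Pair) : Prop :=
  (∀ i, ContDiffOn ℝ ∞ (fun p : ℝ × ℝ × ℝ => Ψ p.1 p.2.1 i p.2.2)
    (Set.univ ×ˢ (I ×ˢ Set.univ))) ∧
    ∀ s, ∀ u ∈ I, Ψ s u ∈ stiefel V

/-- The energy of a path over `[a, b]`. -/
def energy (a b : ℝ) (Φ : ℝ → Pair) : ℝ :=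
  (1 / 2) * ∫ u in a..b, gL2 (velocity Φ u) (velocity Φ u)

/-- Geodesics of `St₂(V)`: the smooth paths on `I` which are, over every compact subinterval `[a, b]`,
critical points of the energy among smooth variations in `St₂(V)` with fixed endpoints. -/
def IsGeodesic (V : Submodule ℂ (ℝ → ℂ)) (I : Set ℝ) (Φ : ℝ → Pair) : Prop :=
  IsSmoothPath V I Φ ∧
    ∀ a b : ℝ, a < b → Set.Icc a b ⊆ I →
      ∀ Ψ : ℝ → ℝ → Pair, IsSmoothFamily V I Ψ → (∀ u ∈ I, Ψ 0 u = Φ u) →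
        (∀ s, Ψ s a = Φ a) → (∀ s, Ψ s b = Φ b) →
          HasDerivAt (fun s => energy a b (Ψ s)) 0 0

/-- The path
`u ↦ (Φ, F) exp (u [[Φ*F, -F*F], [1, Φ*F]]) Id_{4×2} exp (-u Φ*F)`. -/
def expPath (Φ F : Pair) (u : ℝ) : Pair :=
  rmul (Sum.elim Φ F)
    (NormedSpace.exp ((u : ℂ) • Matrix.fromBlocks (adj Φ F) (-adj F F)
        (1 : Matrix (Fin 2) (Fin 2) ℂ) (adj Φ F)) *
      (Matrix.fromRows 1 0 : Matrix (Fin 2 ⊕ Fin 2) (Fin 2) ℂ) *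
      NormedSpace.exp (-(u : ℂ) • adj Φ F))

/-! ### The Grassmannian -/

/-- The Grassmannian of complex `2`-planes in `V`. -/
def grassmannian (V : Submodule ℂ (ℝ → ℂ)) : Set (Submodule ℂ (ℝ → ℂ)) :=
  {P | P ≤ V ∧ Module.finrank ℂ P = 2}

/-- The plane `[Φ]` spanned by `Φ`. -/
def plane (Φ : Pair) : Submodule ℂ (ℝ → ℂ) := Submodule.span ℂ (Set.range Φ)

/-- The component of `F` that is orthogonal to the `U(2)`-orbit of `Φ`, for `F` tangent at `Φ`. -/
def horPart (Φ F : Pair) : Pair := F - rmul Φ (adj Φ F)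

/-- `Ψ` is a smooth lift over `I` of the path `c` of planes. As `I` is an interval, smooth paths in
`St₂(V) / U(2)` are the paths that have such a lift. -/
def IsLift (V : Submodule ℂ (ℝ → ℂ)) (I : Set ℝ) (c : ℝ → Submodule ℂ (ℝ → ℂ))
    (Ψ : ℝ → Pair) : Prop :=
  IsSmoothPath V I Ψ ∧ ∀ u ∈ I, plane (Ψ u) = c u

/-- The energy over `[a, b]` of the path of planes `u ↦ [Φ u]` for the quotient metric on
`St₂(V) / U(2)`: the length of a tangent vector is that of the horizontal part of a lift. -/
def horEnergy (a b : ℝ) (Φ : ℝ → Pair) : ℝ :=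
  (1 / 2) * ∫ u in a..b,
    gL2 (horPart (Φ u) (velocity Φ u)) (horPart (Φ u) (velocity Φ u))

/-- Geodesics of `Gr₂(V)`: the smooth paths of planes on `I` which are, over every compact subinterval
`[a, b]`, critical points of the energy of the quotient metric among smooth variations in `Gr₂(V)` with
fixed endpoints. The variation of planes is `(s, u) ↦ [Ψ s u]`. -/
def IsGrGeodesic (V : Submodule ℂ (ℝ → ℂ)) (I : Set ℝ) (c : ℝ → Submodule ℂ (ℝ → ℂ)) : Prop :=
  (∃ Φ, IsLift V I c Φ) ∧
    ∀ a b : ℝ, a < b → Set.Icc a b ⊆ I →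
      ∀ Ψ : ℝ → ℝ → Pair, IsSmoothFamily V I Ψ → (∀ u ∈ I, plane (Ψ 0 u) = c u) →
        (∀ s, plane (Ψ s a) = c a) → (∀ s, plane (Ψ s b) = c b) →
          HasDerivAt (fun s => horEnergy a b (Ψ s)) 0 0

/-- A frame in `V` together with a horizontal tangent vector at it. -/
structure HorVec (V : Submodule ℂ (ℝ → ℂ)) where
  frame : Pair
  vec : Pair
  frame_mem : frame ∈ stiefel V
  vec_mem : vec ∈ horizontal V frame

theorem rmul_one (Φ : Pair) : rmul Φ (1 : Matrix (Fin 2) (Fin 2) ℂ) = Φ := by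
  funext j t
  simp [rmul, Matrix.one_apply]

theorem rmul_mul (Φ : Pair) (A B : Matrix (Fin 2) (Fin 2) ℂ) :
    rmul (rmul Φ A) B = rmul Φ (A * B) := by
  funext j t
  simp only [rmul, Matrix.mul_apply, Fin.sum_univ_two]
  ring

/-- Two horizontal vectors represent the same tangent vector of `Gr₂(V)` if they differ by the action
of `U(2)`. -/
def horVecSetoid (V : Submodule ℂ (ℝ → ℂ)) : Setoid (HorVec V) where
  r x y := ∃ U ∈ Matrix.unitaryGroup (Fin 2) ℂ, y.frame = rmul x.frame U ∧ y.vec = rmul x.vec U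
  iseqv := by
    refine ⟨fun x => ⟨1, one_mem _, (rmul_one _).symm, (rmul_one _).symm⟩, ?_, ?_⟩
    · rintro x y ⟨U, hU, h1, h2⟩
      refine ⟨star U, Unitary.star_mem hU, ?_, ?_⟩
      · rw [h1, rmul_mul, (Matrix.mem_unitaryGroup_iff).1 hU, rmul_one]
      · rw [h2, rmul_mul, (Matrix.mem_unitaryGroup_iff).1 hU, rmul_one]
    · rintro x y z ⟨U, hU, h1, h2⟩ ⟨W, hW, h3, h4⟩
      exact ⟨U * W, mul_mem hU hW, by rw [h3, h1, rmul_mul], by rw [h4, h2, rmul_mul]⟩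

/-- The tangent bundle of `Gr₂(V)`: the horizontal bundle of `St₂(V)` modulo `U(2)`. -/
def GrTangent (V : Submodule ℂ (ℝ → ℂ)) : Type := Quotient (horVecSetoid V)

/-- The tangent vector of `Gr₂(V)` at `[x.frame]` represented by `x`. -/
def HorVec.toGr {V : Submodule ℂ (ℝ → ℂ)} (x : HorVec V) : GrTangent V :=
  Quotient.mk (horVecSetoid V) x

/-- The path `c` of planes has the velocity `ξ` (at the base point of `ξ`) at `u = 0`. -/
def HasInitialVelocity (V : Submodule ℂ (ℝ → ℂ)) (I : Set ℝ) (c : ℝ → Submodule ℂ (ℝ → ℂ))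
    (ξ : GrTangent V) : Prop :=
  ∃ (Ψ : ℝ → Pair) (x : HorVec V), IsLift V I c Ψ ∧ x.toGr = ξ ∧
    x.frame = Ψ 0 ∧ x.vec = horPart (Ψ 0) (velocity Ψ 0)

/-- `Q` is a value at time `1` of a geodesic of `Gr₂(V)` that starts with velocity `ξ` and is defined on
some open interval containing `[0, 1]`. -/
def IsGrExp (V : Submodule ℂ (ℝ → ℂ)) (ξ : GrTangent V) (Q : Submodule ℂ (ℝ → ℂ)) : Prop :=
  ∃ (I : Set ℝ) (c : ℝ → Submodule ℂ (ℝ → ℂ)), IsOpen I ∧ I.OrdConnected ∧ Set.Icc 0 1 ⊆ I ∧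
    IsGrGeodesic V I c ∧ HasInitialVelocity V I c ξ ∧ c 1 = Q

end FramedLoop

end

/-!
Write `Φ*F` for the matrix `gram Φ F` of inner products and `'` for derivatives in the path parameter.

The geodesic equation in the Stiefel manifold is the Euler-Lagrange equation of the energy. The first
variation is the integral of `-⟨Y, Φ''⟩`, for `Y` the variation field (`IsSmoothFamily.hasDerivAt_energy`),
and tangent vectors at `Φ` are orthogonal to `Φ C` for every Hermitian `C` (`gL2_rmul_eq_zero`), so
`Φ'' + Φ Φ'*Φ' = 0` is sufficient. It is necessary because its left side `D` is itself a tangent field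
and can be used, after a cut-off, as a variation field: the explicit paths `expPath (Φ u) (χ u D u)`
form a smooth family that stays in the Stiefel manifold (`IsSmoothPath.exists_variation`).

To solve the equation, observe that `A = Φ*Φ'` is constant and that `Φ'*Φ'` evolves by conjugation with
`exp (u A)`. Hence `(Φ, Φ') exp (u A)` solves a linear system with constant coefficients, which gives
both the formula and uniqueness (`IsSmoothPath.eq_expPath`). Conversely the generator of this system is
skew for the Gram matrix of the initial data (`geodesicGenerator_skew`), so its flow preserves the
orthonormality of the frame (`gram_expPath`).

For paths of planes one works with an arbitrary lift `Ψ` to frames, with horizontal velocity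
`P = Ψ' - Ψ Ψ*Ψ'`. The Euler-Lagrange equation says that the tension field `grTension Ψ` vanishes
(`isGrGeodesic_iff`), a condition that is independent of the lift (`grTension_of_plane_eq`). A horizontal
solution of the equation in the Stiefel manifold satisfies it. For uniqueness no horizontal lift has to be
constructed: the operator `P Ψ* - Ψ P*` is conserved (`IsSmoothPath.momentum_eq`). If `Φ` is the explicit
horizontal geodesic with the same initial velocity, this conservation law yields `K' = K Ψ*Ψ'` for
`K = Φ*Ψ`, so `K` stays unitary and `Φ`, `Ψ` span the same plane (`plane_eq_of_grTension_eq_zero`).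

The smoothness statements rest on the smooth dependence of integrals on parameters
(`contDiffOn_integral_param`). The only facts about loops and antiloops that matter are collected in
`IsTwistedLoopSpace`.
-/

noncomputable section

open Set Filter Topology MeasureTheory
open scoped Matrix ContDiff

namespace FramedLoop

/-! ### Smooth dependence of integrals on parameters -/

section ParametricIntegral

theorem continuousOn_slice {E G : Type} [TopologicalSpace E] [TopologicalSpace G]
    {O : Set E} {J : Set ℝ} {a b : ℝ} {f : E × ℝ → G}
    (hf : ContinuousOn f (O ×ˢ J)) {x : E} (hx : x ∈ O) (hab : uIcc a b ⊆ J) :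
    ContinuousOn (fun t => f (x, t)) (uIcc a b) :=
  hf.comp (by fun_prop) fun _ ht => ⟨hx, hab ht⟩

variable {E F : Type} [NormedAddCommGroup E] [NormedSpace ℝ E]
  [NormedAddCommGroup F] [NormedSpace ℝ F] {O : Set E} {J : Set ℝ} {a b : ℝ}

/-- Differentiation under the integral sign. The bound on the derivative that dominated convergence
needs comes from the compactness of the interval and holds near the given parameter. -/
theorem hasFDerivAt_integral_param (hO : IsOpen O) (hJ : IsOpen J) (hab : uIcc a b ⊆ J)
    {f : E × ℝ → F} (hf : ContDiffOn ℝ ∞ f (O ×ˢ J)) {x : E} (hx : x ∈ O) :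
    HasFDerivAt (fun y => ∫ t in a..b, f (y, t))
      (∫ t in a..b, (fderiv ℝ f (x, t)).comp (ContinuousLinearMap.inl ℝ E ℝ)) x := by
  have hOJ : IsOpen (O ×ˢ J) := hO.prod hJ
  have hcont : ContinuousOn (fun p => (fderiv ℝ f p).comp (ContinuousLinearMap.inl ℝ E ℝ))
      (O ×ˢ J) :=
    (hf.continuousOn_fderiv_of_isOpen hOJ (by simp)).clm_comp continuousOn_const
  have hK := continuousOn_slice hcont hx hab
  obtain ⟨C, hC⟩ := (isCompact_uIcc (a := a) (b := b)).exists_bound_of_continuousOn hK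
  have hev : ∀ᶠ y in 𝓝 x, ∀ t ∈ uIcc a b, y ∈ O ∧
      ‖(fderiv ℝ f (y, t)).comp (ContinuousLinearMap.inl ℝ E ℝ)‖ ≤ C + 1 := by
    refine (isCompact_uIcc (a := a) (b := b)).eventually_forall_of_forall_eventually
      (P := fun y t => y ∈ O ∧
        ‖(fderiv ℝ f (y, t)).comp (ContinuousLinearMap.inl ℝ E ℝ)‖ ≤ C + 1) ?_
    intro t ht
    have hmem : O ×ˢ J ∈ 𝓝 (x, t) := hOJ.mem_nhds ⟨hx, hab ht⟩
    have h1 := (hcont.continuousAt hmem).norm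
    have h2 := h1.eventually (gt_mem_nhds (lt_of_le_of_lt (hC t ht) (lt_add_one C)))
    filter_upwards [h2, hmem] with z hz hz'
    exact ⟨hz'.1, hz.le⟩
  refine intervalIntegral.hasFDerivAt_integral_of_dominated_of_fderiv_le
    (bound := fun _ => C + 1) (F := fun y t => f (y, t))
    (F' := fun y t => (fderiv ℝ f (y, t)).comp (ContinuousLinearMap.inl ℝ E ℝ))
    hev ?_ ?_ ?_ ?_ intervalIntegrable_const ?_
  · filter_upwards [hO.mem_nhds hx] with y hy
    exact ((continuousOn_slice hf.continuousOn hy hab).mono uIoc_subset_uIcc).aestronglyMeasurable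
      measurableSet_uIoc
  · exact (continuousOn_slice hf.continuousOn hx hab).intervalIntegrable
  · exact (hK.mono uIoc_subset_uIcc).aestronglyMeasurable measurableSet_uIoc
  · exact ae_of_all _ fun t ht y hy => (hy t (uIoc_subset_uIcc ht)).2
  · refine ae_of_all _ fun t ht y hy => ?_
    have ht' := uIoc_subset_uIcc ht
    have h1 : HasFDerivAt f (fderiv ℝ f (y, t)) (y, t) :=
      ((hf.contDiffAt (hOJ.mem_nhds ⟨(hy t ht').1, hab ht'⟩)).differentiableAt
        (by simp)).hasFDerivAt
    exact h1.comp y (hasFDerivAt_prodMk_left y t)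

theorem contDiffOn_integral_param (hO : IsOpen O) (hJ : IsOpen J) (hab : uIcc a b ⊆ J)
    {f : E × ℝ → F} (hf : ContDiffOn ℝ ∞ f (O ×ˢ J)) :
    ContDiffOn ℝ ∞ (fun x => ∫ t in a..b, f (x, t)) O := by
  rw [contDiffOn_infty]
  intro n
  induction n generalizing F with
  | zero =>
    refine contDiffOn_zero.2 fun x hx => ?_
    exact (hasFDerivAt_integral_param hO hJ hab hf hx).continuousAt.continuousWithinAt
  | succ n ih =>
    refine (contDiffOn_succ_iff_hasFDerivWithinAt_of_uniqueDiffOn hO.uniqueDiffOn).2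
      ⟨by simp, _, ih (f := fun p =>
        (fderiv ℝ f p).comp (ContinuousLinearMap.inl ℝ E ℝ)) ?_, fun x hx =>
        (hasFDerivAt_integral_param hO hJ hab hf hx).hasFDerivWithinAt⟩
    exact (hf.fderiv_of_isOpen (hO.prod hJ) (by simp)).clm_comp contDiffOn_const

theorem hasDerivAt_integral_param [CompleteSpace F] {O : Set ℝ} (hO : IsOpen O) (hJ : IsOpen J)
    (hab : uIcc a b ⊆ J) {f : ℝ × ℝ → F} (hf : ContDiffOn ℝ ∞ f (O ×ˢ J)) {u : ℝ} (hu : u ∈ O) :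
    HasDerivAt (fun v => ∫ t in a..b, f (v, t)) (∫ t in a..b, deriv (fun v => f (v, t)) u) u := by
  have h := (hasFDerivAt_integral_param hO hJ hab hf hu).hasDerivAt
  have hOJ : IsOpen (O ×ˢ J) := hO.prod hJ
  have hcont : ContinuousOn (fun p => (fderiv ℝ f p).comp (ContinuousLinearMap.inl ℝ ℝ ℝ))
      (O ×ˢ J) :=
    (hf.continuousOn_fderiv_of_isOpen hOJ (by simp)).clm_comp continuousOn_const
  rw [ContinuousLinearMap.intervalIntegral_apply (continuousOn_slice hcont hu hab).intervalIntegrable] at h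
  convert h using 1
  refine intervalIntegral.integral_congr fun t ht => ?_
  have h1 : HasFDerivAt f (fderiv ℝ f (u, t)) (u, t) :=
    ((hf.contDiffAt (hOJ.mem_nhds ⟨hu, hab ht⟩)).differentiableAt (by simp)).hasFDerivAt
  exact (h1.comp u (hasFDerivAt_prodMk_left u t)).hasDerivAt.deriv

end ParametricIntegral

/-! ### Gram matrices and the matrix action on rows of functions -/

section Algebra

variable {k l m n : Type}

/-- The matrix `Φ* F` for rows `Φ`, `F` of arbitrary lengths; `adj` is the case of two pairs. -/
def gram (Φ : m → ℝ → ℂ) (F : n → ℝ → ℂ) : Matrix m n ℂ := Matrix.of fun i j => l2Inner (F j) (Φ i)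

theorem adj_eq_gram (Φ F : Pair) : adj Φ F = gram Φ F := rfl

theorem gram_apply (Φ : m → ℝ → ℂ) (F : n → ℝ → ℂ) (i : m) (j : n) :
    gram Φ F i j = l2Inner (F j) (Φ i) := rfl

theorem star_l2Inner (f g : ℝ → ℂ) : starRingEnd ℂ (l2Inner f g) = l2Inner g f := by
  unfold l2Inner
  rw [← intervalIntegral.intervalIntegral_conj]
  exact intervalIntegral.integral_congr fun t _ => by simp [mul_comm]

theorem l2Inner_sum_left {f : m → ℝ → ℂ} {g : ℝ → ℂ} (c : m → ℂ) [Fintype m]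
    (hf : ∀ i, Continuous (f i)) (hg : Continuous g) :
    l2Inner (fun t => ∑ i, f i t * c i) g = ∑ i, l2Inner (f i) g * c i := by
  unfold l2Inner
  have hg' : Continuous fun t => starRingEnd ℂ (g t) := Complex.continuous_conj.comp hg
  simp_rw [← intervalIntegral.integral_mul_const]
  rw [← intervalIntegral.integral_finsetSum]
  · refine intervalIntegral.integral_congr fun t _ => ?_
    simp only [Finset.sum_mul]
    exact Finset.sum_congr rfl fun i _ => by ring
  · intro i _
    exact (((hf i).mul hg').mul continuous_const).intervalIntegrable _ _

theorem l2Inner_add_left {f f' g : ℝ → ℂ} (hf : Continuous f) (hf' : Continuous f')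
    (hg : Continuous g) : l2Inner (f + f') g = l2Inner f g + l2Inner f' g := by
  have hg' : Continuous fun t => starRingEnd ℂ (g t) := Complex.continuous_conj.comp hg
  unfold l2Inner
  refine Eq.trans ?_ (intervalIntegral.integral_add ((hf.mul hg').intervalIntegrable _ _)
    ((hf'.mul hg').intervalIntegrable _ _))
  exact intervalIntegral.integral_congr fun t _ => by simp [add_mul]

theorem gram_conjTranspose (Φ : m → ℝ → ℂ) (F : n → ℝ → ℂ) : (gram Φ F)ᴴ = gram F Φ := by
  ext i j
  exact star_l2Inner _ _

theorem gram_rmul_right [Fintype n] {Φ : m → ℝ → ℂ} {F : n → ℝ → ℂ} (hΦ : ∀ i, Continuous (Φ i))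
    (hF : ∀ i, Continuous (F i)) (B : Matrix n l ℂ) : gram Φ (rmul F B) = gram Φ F * B := by
  ext i j
  simp only [gram_apply, Matrix.mul_apply]
  exact l2Inner_sum_left (fun k => B k j) hF (hΦ i)

theorem gram_rmul_left [Fintype m] {Φ : m → ℝ → ℂ} {F : n → ℝ → ℂ} (hΦ : ∀ i, Continuous (Φ i))
    (hF : ∀ i, Continuous (F i)) (A : Matrix m l ℂ) : gram (rmul Φ A) F = Aᴴ * gram Φ F := by
  rw [← gram_conjTranspose, gram_rmul_right hF hΦ, Matrix.conjTranspose_mul, gram_conjTranspose]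

theorem gram_add_right {Φ : m → ℝ → ℂ} {F G : n → ℝ → ℂ} (hΦ : ∀ i, Continuous (Φ i))
    (hF : ∀ i, Continuous (F i)) (hG : ∀ i, Continuous (G i)) :
    gram Φ (F + G) = gram Φ F + gram Φ G := by
  ext i j
  exact l2Inner_add_left (hF j) (hG j) (hΦ i)

theorem gram_add_left {Φ Ψ : m → ℝ → ℂ} {F : n → ℝ → ℂ} (hΦ : ∀ i, Continuous (Φ i))
    (hΨ : ∀ i, Continuous (Ψ i)) (hF : ∀ i, Continuous (F i)) :
    gram (Φ + Ψ) F = gram Φ F + gram Ψ F := by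
  rw [← gram_conjTranspose, gram_add_right hF hΦ hΨ, Matrix.conjTranspose_add]
  simp only [gram_conjTranspose]

theorem gram_smul_right (Φ : m → ℝ → ℂ) (F : n → ℝ → ℂ) (c : ℂ) :
    gram Φ (c • F) = c • gram Φ F := by
  ext i j
  simp only [gram_apply, Matrix.smul_apply, smul_eq_mul, l2Inner]
  rw [← intervalIntegral.integral_const_mul]
  exact intervalIntegral.integral_congr fun t _ => by simp [mul_assoc]

theorem gram_smul_left (Φ : m → ℝ → ℂ) (F : n → ℝ → ℂ) (c : ℂ) :
    gram (c • Φ) F = starRingEnd ℂ c • gram Φ F := by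
  rw [← gram_conjTranspose, gram_smul_right, Matrix.conjTranspose_smul, gram_conjTranspose]
  rfl

theorem gram_neg_right (Φ : m → ℝ → ℂ) (F : n → ℝ → ℂ) : gram Φ (-F) = -gram Φ F := by
  have := gram_smul_right Φ F (-1)
  simpa using this

theorem gram_neg_left (Φ : m → ℝ → ℂ) (F : n → ℝ → ℂ) : gram (-Φ) F = -gram Φ F := by
  have := gram_smul_left Φ F (-1)
  simpa using this

theorem gram_sub_right {Φ : m → ℝ → ℂ} {F G : n → ℝ → ℂ} (hΦ : ∀ i, Continuous (Φ i))
    (hF : ∀ i, Continuous (F i)) (hG : ∀ i, Continuous (G i)) :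
    gram Φ (F - G) = gram Φ F - gram Φ G := by
  rw [sub_eq_add_neg, gram_add_right (G := -G) hΦ hF fun i => (hG i).neg, gram_neg_right, sub_eq_add_neg]

theorem gram_sub_left {Φ Ψ : m → ℝ → ℂ} {F : n → ℝ → ℂ} (hΦ : ∀ i, Continuous (Φ i))
    (hΨ : ∀ i, Continuous (Ψ i)) (hF : ∀ i, Continuous (F i)) :
    gram (Φ - Ψ) F = gram Φ F - gram Ψ F := by
  rw [← gram_conjTranspose, gram_sub_right hF hΦ hΨ, Matrix.conjTranspose_sub]
  simp only [gram_conjTranspose]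

theorem rmul_rmul [Fintype m] [Fintype n] (Φ : m → ℝ → ℂ) (A : Matrix m n ℂ) (B : Matrix n l ℂ) :
    rmul (rmul Φ A) B = rmul Φ (A * B) := by
  funext j t
  simp only [rmul, Matrix.mul_apply, Finset.sum_mul, Finset.mul_sum]
  rw [Finset.sum_comm]
  exact Finset.sum_congr rfl fun i _ => Finset.sum_congr rfl fun i _ => by ring

theorem rmul_one' [Fintype m] [DecidableEq m] (Φ : m → ℝ → ℂ) : rmul Φ (1 : Matrix m m ℂ) = Φ := by
  funext j t
  simp [rmul, Matrix.one_apply]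

theorem rmul_add [Fintype m] (Φ : m → ℝ → ℂ) (A B : Matrix m n ℂ) :
    rmul Φ (A + B) = rmul Φ A + rmul Φ B := by
  funext j t
  simp [rmul, mul_add, Finset.sum_add_distrib]

theorem add_rmul [Fintype m] (Φ Ψ : m → ℝ → ℂ) (A : Matrix m n ℂ) :
    rmul (Φ + Ψ) A = rmul Φ A + rmul Ψ A := by
  funext j t
  simp [rmul, add_mul, Finset.sum_add_distrib]

theorem rmul_neg [Fintype m] (Φ : m → ℝ → ℂ) (A : Matrix m n ℂ) : rmul Φ (-A) = -rmul Φ A := by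
  funext j t
  simp [rmul]

theorem neg_rmul [Fintype m] (Φ : m → ℝ → ℂ) (A : Matrix m n ℂ) : rmul (-Φ) A = -rmul Φ A := by
  funext j t
  simp [rmul]

theorem rmul_sub [Fintype m] (Φ : m → ℝ → ℂ) (A B : Matrix m n ℂ) :
    rmul Φ (A - B) = rmul Φ A - rmul Φ B := by
  rw [sub_eq_add_neg, rmul_add, rmul_neg, sub_eq_add_neg]

theorem sub_rmul [Fintype m] (Φ Ψ : m → ℝ → ℂ) (A : Matrix m n ℂ) :
    rmul (Φ - Ψ) A = rmul Φ A - rmul Ψ A := by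
  rw [sub_eq_add_neg, add_rmul, neg_rmul, sub_eq_add_neg]

theorem rmul_zero [Fintype m] (Φ : m → ℝ → ℂ) : rmul Φ (0 : Matrix m n ℂ) = 0 := by
  funext j t
  simp [rmul]

theorem continuous_rmul [Fintype m] {Φ : m → ℝ → ℂ} (hΦ : ∀ i, Continuous (Φ i))
    (A : Matrix m n ℂ) (j : n) : Continuous (rmul Φ A j) :=
  continuous_finsetSum _ fun i _ => (hΦ i).mul continuous_const

theorem continuous_add_row {F G : m → ℝ → ℂ} (hF : ∀ i, Continuous (F i))
    (hG : ∀ i, Continuous (G i)) (i : m) : Continuous ((F + G) i) := (hF i).add (hG i)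

theorem continuous_sub_row {F G : m → ℝ → ℂ} (hF : ∀ i, Continuous (F i))
    (hG : ∀ i, Continuous (G i)) (i : m) : Continuous ((F - G) i) := (hF i).sub (hG i)

theorem gL2_eq_re_trace (F G : Pair) : gL2 F G = (gram G F).trace.re := rfl

/-- The real part of the trace of a product of a Hermitian and a skew-Hermitian matrix vanishes. -/
theorem re_trace_mul_eq_zero [Fintype m] {C A : Matrix m m ℂ} (hC : Cᴴ = C) (hA : Aᴴ = -A) :
    (C * A).trace.re = 0 := by
  have h : star (C * A).trace = -(C * A).trace := by
    rw [← Matrix.trace_conjTranspose, Matrix.conjTranspose_mul, hC, hA, Matrix.neg_mul,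
      Matrix.trace_neg, Matrix.trace_mul_comm]
  have := congrArg Complex.re h
  simp at this
  linarith

end Algebra

/-! ### Jointly smooth families of rows of functions -/

section JointSmooth

variable {E E' : Type} [NormedAddCommGroup E] [NormedSpace ℝ E] [NormedAddCommGroup E']
  [NormedSpace ℝ E'] {m n : Type} {O : Set E}

/-- The family `x ↦ X x` of rows of functions of `t` is jointly smooth in `(x, t)` over `O`. -/
def JointSmoothOn (O : Set E) (X : E → m → ℝ → ℂ) : Prop :=
  ∀ i, ContDiffOn ℝ ∞ (fun p : E × ℝ => X p.1 i p.2) (O ×ˢ univ)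

/-- The entries of the matrix `A x` depend smoothly on `x ∈ O`. -/
def EntrySmoothOn (O : Set E) (A : E → Matrix m n ℂ) : Prop :=
  ∀ i j, ContDiffOn ℝ ∞ (fun x => A x i j) O

theorem JointSmoothOn.contDiff {X : E → m → ℝ → ℂ} (hX : JointSmoothOn O X) {x : E} (hx : x ∈ O)
    (i : m) : ContDiff ℝ ∞ (X x i) := by
  rw [← contDiffOn_univ]
  exact (hX i).comp (f := fun t : ℝ => (x, t)) (contDiff_const.prodMk contDiff_id).contDiffOn
    fun t _ => ⟨hx, mem_univ t⟩

theorem JointSmoothOn.continuous {X : E → m → ℝ → ℂ} (hX : JointSmoothOn O X) {x : E} (hx : x ∈ O)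
    (i : m) : Continuous (X x i) := (hX.contDiff hx i).continuous

theorem JointSmoothOn.comp {X : E → m → ℝ → ℂ} (hX : JointSmoothOn O X) {O' : Set E'} {g : E' → E}
    (hg : ContDiffOn ℝ ∞ g O') (h : MapsTo g O' O) : JointSmoothOn O' (fun x => X (g x)) := by
  intro i
  refine (hX i).comp (f := fun p : E' × ℝ => (g p.1, p.2)) ?_ fun p hp => ⟨h hp.1, hp.2⟩
  exact (hg.comp contDiff_fst.contDiffOn fun p hp => hp.1).prodMk contDiff_snd.contDiffOn

theorem JointSmoothOn.congr {X Y : E → m → ℝ → ℂ} (hX : JointSmoothOn O X)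
    (h : ∀ x ∈ O, Y x = X x) : JointSmoothOn O Y := fun i =>
  (hX i).congr fun p hp => by rw [h p.1 hp.1]

theorem JointSmoothOn.add {X Y : E → m → ℝ → ℂ} (hX : JointSmoothOn O X) (hY : JointSmoothOn O Y) :
    JointSmoothOn O (fun x => X x + Y x) := fun i => (hX i).add (hY i)

theorem JointSmoothOn.sub {X Y : E → m → ℝ → ℂ} (hX : JointSmoothOn O X) (hY : JointSmoothOn O Y) :
    JointSmoothOn O (fun x => X x - Y x) := fun i => (hX i).sub (hY i)

theorem JointSmoothOn.smul {X : E → m → ℝ → ℂ} (hX : JointSmoothOn O X) {χ : E → ℂ}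
    (hχ : ContDiffOn ℝ ∞ χ O) : JointSmoothOn O (fun x => χ x • X x) := fun i =>
  (hχ.comp contDiff_fst.contDiffOn fun _ hp => hp.1).mul (hX i)

theorem JointSmoothOn.rmul [Fintype m] {X : E → m → ℝ → ℂ} (hX : JointSmoothOn O X)
    {A : E → Matrix m n ℂ} (hA : EntrySmoothOn O A) :
    JointSmoothOn O (fun x => rmul (X x) (A x)) := fun j =>
  ContDiffOn.sum fun i _ => (hX i).mul ((hA i j).comp contDiff_fst.contDiffOn fun _ hp => hp.1)

theorem JointSmoothOn.sumElim {X : E → m → ℝ → ℂ} {Y : E → n → ℝ → ℂ} (hX : JointSmoothOn O X)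
    (hY : JointSmoothOn O Y) : JointSmoothOn O (fun x => Sum.elim (X x) (Y x)) := by
  rintro (i | i)
  exacts [hX i, hY i]

theorem JointSmoothOn.gram (hO : IsOpen O) {X : E → m → ℝ → ℂ} {Y : E → n → ℝ → ℂ}
    (hX : JointSmoothOn O X) (hY : JointSmoothOn O Y) :
    EntrySmoothOn O (fun x => gram (X x) (Y x)) := fun i j =>
  contDiffOn_integral_param (f := fun p : E × ℝ => Y p.1 j p.2 * starRingEnd ℂ (X p.1 i p.2))
    hO isOpen_univ (subset_univ _) ((hY j).mul (Complex.conjCLE.contDiff.comp_contDiffOn (hX i)))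

theorem entrySmoothOn_const (A : Matrix m n ℂ) : EntrySmoothOn O (fun _ => A) :=
  fun _ _ => contDiffOn_const

theorem EntrySmoothOn.neg {A : E → Matrix m n ℂ} (hA : EntrySmoothOn O A) :
    EntrySmoothOn O (fun x => -A x) :=
  fun i j => (hA i j).neg

theorem EntrySmoothOn.smul {A : E → Matrix m n ℂ} (hA : EntrySmoothOn O A) {χ : E → ℂ}
    (hχ : ContDiffOn ℝ ∞ χ O) : EntrySmoothOn O (fun x => χ x • A x) :=
  fun i j => hχ.mul (hA i j)

theorem EntrySmoothOn.mul {k : Type} [Fintype n] {A : E → Matrix m n ℂ} {B : E → Matrix n k ℂ}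
    (hA : EntrySmoothOn O A) (hB : EntrySmoothOn O B) : EntrySmoothOn O (fun x => A x * B x) :=
  fun i j => ContDiffOn.sum fun k _ => (hA i k).mul (hB k j)

open scoped Matrix.Norms.Operator in
theorem EntrySmoothOn.exp [Fintype m] [DecidableEq m] {A : E → Matrix m m ℂ}
    (hA : EntrySmoothOn O A) : EntrySmoothOn O (fun x => NormedSpace.exp (A x)) := by
  have h1 : ContDiffOn ℝ ∞ A O := by
    have h : A = fun x => ∑ i, ∑ j, A x i j • Matrix.single i j (1 : ℂ) := by
      funext x
      conv_lhs => rw [Matrix.matrix_eq_sum_single (A x)]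
      simp
    rw [h]
    exact ContDiffOn.sum fun i _ => ContDiffOn.sum fun j _ => (hA i j).smul contDiffOn_const
  have h2 : ContDiff ℝ ∞ (NormedSpace.exp : Matrix m m ℂ → Matrix m m ℂ) :=
    contDiff_iff_contDiffAt.2 fun x => (NormedSpace.exp_analytic (𝕂 := ℝ) x).contDiffAt
  intro i j
  exact (LinearMap.toContinuousLinearMap
    (Matrix.entryLinearMap ℝ ℂ i j)).contDiff.comp_contDiffOn (h2.comp_contDiffOn h1)

/-- The derivative of a jointly smooth family in the direction `v` of the parameter. -/
def paramDeriv (X : E → m → ℝ → ℂ) (v : E) : E → m → ℝ → ℂ :=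
  fun x i t => fderiv ℝ (fun p : E × ℝ => X p.1 i p.2) (x, t) (v, 0)

theorem JointSmoothOn.paramDeriv (hO : IsOpen O) {X : E → m → ℝ → ℂ} (hX : JointSmoothOn O X)
    (v : E) : JointSmoothOn O (paramDeriv X v) := fun i =>
  ((hX i).fderiv_of_isOpen (hO.prod isOpen_univ) (by simp)).clm_apply contDiffOn_const

theorem JointSmoothOn.hasDerivAt_comp (hO : IsOpen O) {X : E → m → ℝ → ℂ} (hX : JointSmoothOn O X)
    {γ : ℝ → E} {v : E} {r : ℝ} (hγ : HasDerivAt γ v r) (hr : γ r ∈ O) (i : m) (t : ℝ) :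
    HasDerivAt (fun q => X (γ q) i t) (FramedLoop.paramDeriv X v (γ r) i t) r := by
  have h1 : HasFDerivAt (fun p : E × ℝ => X p.1 i p.2)
      (fderiv ℝ (fun p : E × ℝ => X p.1 i p.2) (γ r, t)) (γ r, t) :=
    (((hX i).contDiffAt ((hO.prod isOpen_univ).mem_nhds ⟨hr, mem_univ t⟩)).differentiableAt
      (by simp)).hasFDerivAt
  exact HasFDerivAt.comp_hasDerivAt (f := fun q => (γ q, t)) r h1 (hγ.prodMk (hasDerivAt_const r t))

theorem JointSmoothOn.paramDeriv_comm (hO : IsOpen O) {X : E → m → ℝ → ℂ}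
    (hX : JointSmoothOn O X) (v w : E) {x : E} (hx : x ∈ O) :
    FramedLoop.paramDeriv (FramedLoop.paramDeriv X v) w x =
      FramedLoop.paramDeriv (FramedLoop.paramDeriv X w) v x := by
  funext i t
  have hmem : O ×ˢ univ ∈ 𝓝 (x, t) := (hO.prod isOpen_univ).mem_nhds ⟨hx, mem_univ t⟩
  have hC := (hX i).contDiffAt hmem
  have hsymm := hC.isSymmSndFDerivAt
    (by simpa using WithTop.coe_le_coe.2 (le_top : (2 : ℕ∞) ≤ ⊤))
  have hd : DifferentiableAt ℝ (fderiv ℝ fun p : E × ℝ => X p.1 i p.2) (x, t) :=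
    (hC.fderiv_right (m := ∞) (by simp)).differentiableAt (by simp)
  have key : ∀ v w : E, FramedLoop.paramDeriv (FramedLoop.paramDeriv X v) w x i t =
      fderiv ℝ (fderiv ℝ fun p : E × ℝ => X p.1 i p.2) (x, t) (w, 0) (v, 0) := by
    intro v w
    have := hd.hasFDerivAt.clm_apply (hasFDerivAt_const ((v, 0) : E × ℝ) (x, t))
    have h2 := congrArg (fun L => L ((w, 0) : E × ℝ)) this.fderiv
    simpa [FramedLoop.paramDeriv] using h2
  rw [key, key]
  exact hsymm _ _

end JointSmooth

/-! ### Derivatives of paths of rows and of matrices -/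

section Velocity

variable {k m n : Type} {u : ℝ}

/-- The path `Φ` of rows of functions has, pointwise in the function variable, the derivative `F`
at `u`. -/
def HasVelocityAt (Φ : ℝ → m → ℝ → ℂ) (F : m → ℝ → ℂ) (u : ℝ) : Prop :=
  ∀ i t, HasDerivAt (fun v => Φ v i t) (F i t) u

/-- The path `A` of matrices has the entrywise derivative `A'` at `u`. This avoids the choice of a norm
on matrices. -/
def HasEntryDerivAt (A : ℝ → Matrix m n ℂ) (A' : Matrix m n ℂ) (u : ℝ) : Prop :=
  ∀ i j, HasDerivAt (fun v => A v i j) (A' i j) u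

theorem HasVelocityAt.velocity_eq {Φ : ℝ → Pair} {F : Pair} (h : HasVelocityAt Φ F u) :
    velocity Φ u = F := by
  funext i t
  exact (h i t).deriv

theorem HasVelocityAt.congr_velocity {Φ : ℝ → m → ℝ → ℂ} {F G : m → ℝ → ℂ}
    (h : HasVelocityAt Φ F u) (e : F = G) : HasVelocityAt Φ G u := e ▸ h

theorem HasVelocityAt.sub {Φ Ψ : ℝ → m → ℝ → ℂ} {F G : m → ℝ → ℂ} (hΦ : HasVelocityAt Φ F u)
    (hΨ : HasVelocityAt Ψ G u) : HasVelocityAt (fun v => Φ v - Ψ v) (F - G) u :=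
  fun i t => (hΦ i t).sub (hΨ i t)

theorem HasVelocityAt.congr {Φ Ψ : ℝ → m → ℝ → ℂ} {F : m → ℝ → ℂ} (hΦ : HasVelocityAt Φ F u)
    (h : ∀ᶠ v in 𝓝 u, Ψ v = Φ v) : HasVelocityAt Ψ F u :=
  fun i t => (hΦ i t).congr_of_eventuallyEq (h.mono fun v hv => by simp only [hv])

theorem hasVelocityAt_const (F : m → ℝ → ℂ) : HasVelocityAt (fun _ => F) 0 u :=
  fun i t => hasDerivAt_const u (F i t)

theorem HasVelocityAt.rmul [Fintype m] {Φ : ℝ → m → ℝ → ℂ} {F : m → ℝ → ℂ}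
    {A : ℝ → Matrix m n ℂ} {A' : Matrix m n ℂ} (hΦ : HasVelocityAt Φ F u)
    (hA : HasEntryDerivAt A A' u) :
    HasVelocityAt (fun v => rmul (Φ v) (A v)) (rmul F (A u) + rmul (Φ u) A') u := by
  intro j t
  have := HasDerivAt.fun_sum fun i (_ : i ∈ Finset.univ) => (hΦ i t).mul (hA i j)
  rw [Finset.sum_add_distrib] at this
  exact this

theorem hasEntryDerivAt_const (A : Matrix m n ℂ) : HasEntryDerivAt (fun _ => A) 0 u :=
  fun i j => hasDerivAt_const u (A i j)

theorem HasEntryDerivAt.unique {A : ℝ → Matrix m n ℂ} {A' B' : Matrix m n ℂ}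
    (h : HasEntryDerivAt A A' u) (h' : HasEntryDerivAt A B' u) : A' = B' := by
  ext i j
  exact (h i j).unique (h' i j)

theorem HasEntryDerivAt.congr {A B : ℝ → Matrix m n ℂ} {A' : Matrix m n ℂ}
    (h : HasEntryDerivAt A A' u) (h' : ∀ᶠ v in 𝓝 u, B v = A v) : HasEntryDerivAt B A' u :=
  fun i j => (h i j).congr_of_eventuallyEq (h'.mono fun v hv => by simp only [hv])

theorem HasEntryDerivAt.mul [Fintype n] {A : ℝ → Matrix m n ℂ} {A' : Matrix m n ℂ}
    {B : ℝ → Matrix n k ℂ} {B' : Matrix n k ℂ} (hA : HasEntryDerivAt A A' u)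
    (hB : HasEntryDerivAt B B' u) :
    HasEntryDerivAt (fun v => A v * B v) (A' * B u + A u * B') u := by
  intro i j
  have := HasDerivAt.fun_sum fun l (_ : l ∈ Finset.univ) => (hA i l).mul (hB l j)
  rw [Finset.sum_add_distrib] at this
  exact this

theorem HasEntryDerivAt.conjTranspose {A : ℝ → Matrix m n ℂ} {A' : Matrix m n ℂ}
    (hA : HasEntryDerivAt A A' u) : HasEntryDerivAt (fun v => (A v)ᴴ) A'ᴴ u :=
  fun i j => (hA j i).star

open scoped Matrix.Norms.Operator in
theorem hasEntryDerivAt_exp [Fintype m] [DecidableEq m] (A : Matrix m m ℂ) (u : ℝ) :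
    HasEntryDerivAt (fun v : ℝ => NormedSpace.exp ((v : ℂ) • A))
      (NormedSpace.exp ((u : ℂ) • A) * A) u := by
  intro i j
  have h := hasDerivAt_exp_smul_const (𝕂 := ℝ) A u
  have h2 := (LinearMap.toContinuousLinearMap
    (Matrix.entryLinearMap ℝ ℂ i j)).hasFDerivAt.comp_hasDerivAt u h
  simp only [Complex.coe_smul]
  exact h2

/-- An entrywise derivative that vanishes on an open interval forces a path of matrices to be constant
there. All conservation laws below are used in this form. -/
theorem HasEntryDerivAt.eq_of_eq_zero {I : Set ℝ} (hI : IsOpen I) (hI' : I.OrdConnected)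
    {A : ℝ → Matrix m n ℂ} (h : ∀ u ∈ I, HasEntryDerivAt A 0 u) {u v : ℝ} (hu : u ∈ I)
    (hv : v ∈ I) : A u = A v := by
  ext i j
  refine hI.is_const_of_deriv_eq_zero hI'.isPreconnected (f := fun v => A v i j)
    (fun w hw => (h w hw i j).differentiableAt.differentiableWithinAt)
    (fun w hw => (h w hw i j).deriv) hu hv

theorem HasVelocityAt.eq_of_eq_zero {I : Set ℝ} (hI : IsOpen I) (hI' : I.OrdConnected)
    {Φ : ℝ → m → ℝ → ℂ} (h : ∀ u ∈ I, HasVelocityAt Φ 0 u) {u v : ℝ} (hu : u ∈ I)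
    (hv : v ∈ I) : Φ u = Φ v := by
  funext i t
  refine hI.is_const_of_deriv_eq_zero hI'.isPreconnected (f := fun v => Φ v i t)
    (fun w hw => (h w hw i t).differentiableAt.differentiableWithinAt)
    (fun w hw => (h w hw i t).deriv) hu hv

variable {I : Set ℝ} {Φ Ψ : ℝ → Pair}

theorem JointSmoothOn.velocity_eq_paramDeriv (hI : IsOpen I) (hΦ : JointSmoothOn I Φ) (hu : u ∈ I) :
    velocity Φ u = FramedLoop.paramDeriv Φ 1 u := by
  funext i t
  exact (hΦ.hasDerivAt_comp hI (hasDerivAt_id u) hu i t).deriv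

theorem JointSmoothOn.hasVelocityAt (hI : IsOpen I) (hΦ : JointSmoothOn I Φ) (hu : u ∈ I) :
    HasVelocityAt Φ (velocity Φ u) u := by
  rw [hΦ.velocity_eq_paramDeriv hI hu]
  exact fun i t => hΦ.hasDerivAt_comp hI (hasDerivAt_id u) hu i t

theorem JointSmoothOn.velocity (hI : IsOpen I) (hΦ : JointSmoothOn I Φ) :
    JointSmoothOn I (velocity Φ) :=
  (hΦ.paramDeriv hI 1).congr fun _ hx => hΦ.velocity_eq_paramDeriv hI hx

theorem JointSmoothOn.hasEntryDerivAt_gram (hI : IsOpen I) (hΦ : JointSmoothOn I Φ)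
    (hΨ : JointSmoothOn I Ψ) (hu : u ∈ I) :
    HasEntryDerivAt (fun v => FramedLoop.gram (Φ v) (Ψ v))
      (FramedLoop.gram (FramedLoop.velocity Φ u) (Ψ u) +
        FramedLoop.gram (Φ u) (FramedLoop.velocity Ψ u)) u := by
  intro i j
  have hc := Complex.continuous_conj
  have h := hasDerivAt_integral_param (a := 0) (b := 2)
    (f := fun p : ℝ × ℝ => Ψ p.1 j p.2 * starRingEnd ℂ (Φ p.1 i p.2))
    hI isOpen_univ (subset_univ _) ((hΨ j).mul (Complex.conjCLE.contDiff.comp_contDiffOn (hΦ i))) hu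
  refine h.congr_deriv ?_
  simp only [Matrix.add_apply, gram_apply, l2Inner]
  rw [← intervalIntegral.integral_add]
  · refine intervalIntegral.integral_congr fun t _ => ?_
    have := ((hΨ.hasVelocityAt hI hu j t).mul (hΦ.hasVelocityAt hI hu i t).star).deriv
    exact this.trans (add_comm _ _)
  · exact ((hΨ.continuous hu j).mul
      (hc.comp ((hΦ.velocity hI).continuous hu i))).intervalIntegrable _ _
  · exact (((hΨ.velocity hI).continuous hu j).mul
      (hc.comp (hΦ.continuous hu i))).intervalIntegrable _ _

end Velocity

/-! ### Two-parameter families -/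

section Family

variable {I : Set ℝ} {X : ℝ → ℝ → Pair} {s u : ℝ}

/-- The family `(s, u) ↦ X s u` of pairs is jointly smooth in `(s, u, t)` for `u ∈ I`. -/
def FamilySmoothOn (I : Set ℝ) (X : ℝ → ℝ → Pair) : Prop :=
  JointSmoothOn (univ ×ˢ I) (fun p : ℝ × ℝ => X p.1 p.2)

theorem familySmoothOn_iff : FamilySmoothOn I X ↔
    ∀ i, ContDiffOn ℝ ∞ (fun p : ℝ × ℝ × ℝ => X p.1 p.2.1 i p.2.2) (univ ×ˢ (I ×ˢ univ)) := by
  constructor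
  · intro h i
    exact (h i).comp (f := fun p : ℝ × ℝ × ℝ => ((p.1, p.2.1), p.2.2))
      (ContDiff.contDiffOn (by fun_prop)) fun p hp => ⟨⟨mem_univ _, hp.2.1⟩, mem_univ _⟩
  · intro h i
    exact (h i).comp (f := fun p : (ℝ × ℝ) × ℝ => (p.1.1, p.1.2, p.2))
      (ContDiff.contDiffOn (by fun_prop)) fun p hp => ⟨mem_univ _, hp.1.2, mem_univ _⟩

theorem FamilySmoothOn.right (hX : FamilySmoothOn I X) (s : ℝ) : JointSmoothOn I (X s) :=
  JointSmoothOn.comp hX (g := fun u => (s, u)) (by fun_prop) fun _ hu => ⟨mem_univ _, hu⟩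

theorem FamilySmoothOn.left (hX : FamilySmoothOn I X) (hu : u ∈ I) :
    JointSmoothOn univ (fun s => X s u) :=
  JointSmoothOn.comp hX (g := fun s => (s, u)) (by fun_prop) fun _ _ => ⟨mem_univ _, hu⟩

theorem FamilySmoothOn.velocity_right_eq (hI : IsOpen I) (hX : FamilySmoothOn I X) (hu : u ∈ I) :
    velocity (X s) u = paramDeriv (fun p : ℝ × ℝ => X p.1 p.2) (0, 1) (s, u) := by
  funext i t
  exact (JointSmoothOn.hasDerivAt_comp (isOpen_univ.prod hI) hX (γ := fun v => (s, v))
    ((hasDerivAt_const u s).prodMk (hasDerivAt_id u)) ⟨mem_univ _, hu⟩ i t).deriv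

theorem FamilySmoothOn.velocity_left_eq (hI : IsOpen I) (hX : FamilySmoothOn I X) (hu : u ∈ I) :
    velocity (fun r => X r u) s = paramDeriv (fun p : ℝ × ℝ => X p.1 p.2) (1, 0) (s, u) := by
  funext i t
  exact (JointSmoothOn.hasDerivAt_comp (isOpen_univ.prod hI) hX (γ := fun r => (r, u))
    ((hasDerivAt_id s).prodMk (hasDerivAt_const s u)) ⟨mem_univ _, hu⟩ i t).deriv

theorem FamilySmoothOn.velocity_right (hI : IsOpen I) (hX : FamilySmoothOn I X) :
    FamilySmoothOn I (fun s u => velocity (X s) u) :=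
  (JointSmoothOn.paramDeriv (isOpen_univ.prod hI) hX (0, 1)).congr fun _ hp =>
    hX.velocity_right_eq hI hp.2

theorem FamilySmoothOn.velocity_left (hI : IsOpen I) (hX : FamilySmoothOn I X) :
    FamilySmoothOn I (fun s u => velocity (fun r => X r u) s) :=
  (JointSmoothOn.paramDeriv (isOpen_univ.prod hI) hX (1, 0)).congr fun _ hp =>
    hX.velocity_left_eq hI hp.2

/-- Symmetry of the second derivatives in the two parameters of a family. -/
theorem FamilySmoothOn.velocity_comm (hI : IsOpen I) (hX : FamilySmoothOn I X) (hu : u ∈ I) :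
    velocity (fun r => velocity (X r) u) s = velocity (fun v => velocity (fun r => X r v) s) u := by
  have hO : IsOpen ((univ : Set ℝ) ×ˢ I) := isOpen_univ.prod hI
  have hsu : (s, u) ∈ (univ : Set ℝ) ×ˢ I := ⟨mem_univ _, hu⟩
  have h1 : velocity (fun r => velocity (X r) u) s =
      paramDeriv (paramDeriv (fun p : ℝ × ℝ => X p.1 p.2) (0, 1)) (1, 0) (s, u) := by
    refine HasVelocityAt.velocity_eq fun i t => ?_
    simp only [hX.velocity_right_eq hI hu]
    exact JointSmoothOn.hasDerivAt_comp hO (JointSmoothOn.paramDeriv hO hX (0, 1))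
      (γ := fun r => (r, u)) ((hasDerivAt_id s).prodMk (hasDerivAt_const s u)) hsu i t
  have h2 : velocity (fun v => velocity (fun r => X r v) s) u =
      paramDeriv (paramDeriv (fun p : ℝ × ℝ => X p.1 p.2) (1, 0)) (0, 1) (s, u) := by
    refine HasVelocityAt.velocity_eq ?_
    refine HasVelocityAt.congr (Φ := fun v =>
      paramDeriv (fun p : ℝ × ℝ => X p.1 p.2) (1, 0) (s, v)) (fun i t => ?_) ?_
    · exact JointSmoothOn.hasDerivAt_comp hO (JointSmoothOn.paramDeriv hO hX (1, 0))
        (γ := fun v => (s, v)) ((hasDerivAt_const u s).prodMk (hasDerivAt_id u)) hsu i t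
    · filter_upwards [hI.mem_nhds hu] with v hv
      exact hX.velocity_left_eq hI hv
  rw [h1, h2]
  exact JointSmoothOn.paramDeriv_comm hO hX _ _ hsu

end Family

/-! ### One-parameter groups of matrices -/

section MatrixFlow

variable {m : Type} [Fintype m] [DecidableEq m]

/-- The one-parameter group `u ↦ exp (u A)` generated by a complex matrix. -/
def matrixFlow (A : Matrix m m ℂ) (u : ℝ) : Matrix m m ℂ := NormedSpace.exp ((u : ℂ) • A)

theorem matrixFlow_zero (A : Matrix m m ℂ) : matrixFlow A 0 = 1 := by
  simp [matrixFlow]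

theorem hasEntryDerivAt_matrixFlow (A : Matrix m m ℂ) (u : ℝ) :
    HasEntryDerivAt (matrixFlow A) (matrixFlow A u * A) u := hasEntryDerivAt_exp A u

theorem matrixFlow_mul_comm (A : Matrix m m ℂ) (u : ℝ) :
    matrixFlow A u * A = A * matrixFlow A u :=
  (((Commute.refl A).smul_left (u : ℂ)).exp_left).eq

theorem matrixFlow_mul_neg (A : Matrix m m ℂ) (u : ℝ) : matrixFlow A u * matrixFlow (-A) u = 1 := by
  rw [matrixFlow, matrixFlow, smul_neg,
    ← Matrix.exp_add_of_commute _ _ ((Commute.refl ((u : ℂ) • A)).neg_right)]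
  simp

theorem matrixFlow_neg_mul (A : Matrix m m ℂ) (u : ℝ) : matrixFlow (-A) u * matrixFlow A u = 1 := by
  simpa using matrixFlow_mul_neg (-A) u

theorem matrixFlow_conjTranspose (A : Matrix m m ℂ) (u : ℝ) :
    (matrixFlow A u)ᴴ = matrixFlow Aᴴ u := by
  rw [matrixFlow, ← Matrix.exp_conjTranspose, Matrix.conjTranspose_smul]
  simp [matrixFlow]

/-- If `A` is skew for the sesquilinear form `G`, then the flow of `A` preserves `G`. -/
theorem matrixFlow_preserves {A G : Matrix m m ℂ} (h : Aᴴ * G + G * A = 0) (u : ℝ) :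
    (matrixFlow A u)ᴴ * G * matrixFlow A u = G := by
  have key : ∀ u ∈ (univ : Set ℝ),
      HasEntryDerivAt (fun v => (matrixFlow A v)ᴴ * G * matrixFlow A v) 0 u := by
    intro u _
    have h1 := (((hasEntryDerivAt_matrixFlow A u).conjTranspose.mul
      (hasEntryDerivAt_const G)).mul (hasEntryDerivAt_matrixFlow A u))
    have h2 : ((matrixFlow A u * A)ᴴ * G + (matrixFlow A u)ᴴ * 0) * matrixFlow A u +
        (matrixFlow A u)ᴴ * G * (matrixFlow A u * A) =
        (matrixFlow A u)ᴴ * (Aᴴ * G + G * A) * matrixFlow A u := by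
      rw [matrixFlow_mul_comm, Matrix.conjTranspose_mul]
      noncomm_ring
    rwa [h2, h, Matrix.mul_zero, Matrix.zero_mul] at h1
  have := HasEntryDerivAt.eq_of_eq_zero isOpen_univ ordConnected_univ key (mem_univ u) (mem_univ 0)
  simpa [matrixFlow_zero] using this

end MatrixFlow

/-! ### The frames and their tangent vectors in terms of Gram matrices -/

section Frames

variable {V : Submodule ℂ (ℝ → ℂ)} {Φ F : Pair}

theorem mem_stiefel_iff : Φ ∈ stiefel V ↔ (∀ i, Φ i ∈ V) ∧ gram Φ Φ = 1 := by
  refine and_congr_right fun _ => ?_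
  constructor
  · rintro ⟨h0, h1, h01⟩
    ext i j
    have h10 : l2Inner (Φ 1) (Φ 0) = 0 := by rw [← star_l2Inner, h01, map_zero]
    fin_cases i <;> fin_cases j <;> simp [gram_apply, h0, h1, h01, h10]
  · intro h
    exact ⟨congrFun (congrFun h 0) 0, congrFun (congrFun h 1) 1, by
      simpa [gram_apply] using congrFun (congrFun h 1) 0⟩

theorem mem_stiefelTangent_iff :
    F ∈ stiefelTangent V Φ ↔ (∀ i, F i ∈ V) ∧ gram F Φ = -gram Φ F := by
  refine and_congr_right fun _ => ?_
  have hre : ∀ i, l2Inner (Φ i) (F i) = -l2Inner (F i) (Φ i) ↔ (l2Inner (Φ i) (F i)).re = 0 := by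
    intro i
    rw [← star_l2Inner (Φ i) (F i), Complex.ext_iff]
    simp only [Complex.neg_re, Complex.conj_re, Complex.neg_im, Complex.conj_im, neg_neg, and_true]
    constructor <;> intro h <;> linarith
  constructor
  · rintro ⟨h0, h1, h01⟩
    ext i j
    have h01' := congrArg (starRingEnd ℂ) h01
    rw [map_add, star_l2Inner, star_l2Inner, map_zero] at h01'
    fin_cases i <;> fin_cases j
    · exact (hre 0).2 h0
    · exact eq_neg_of_add_eq_zero_right h01'
    · exact eq_neg_of_add_eq_zero_left h01
    · exact (hre 1).2 h1
  · intro h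
    exact ⟨(hre 0).1 (congrFun (congrFun h 0) 0), (hre 1).1 (congrFun (congrFun h 1) 1),
      eq_neg_iff_add_eq_zero.1 (congrFun (congrFun h 1) 0)⟩

theorem mem_horizontal_iff : F ∈ horizontal V Φ ↔ (∀ i, F i ∈ V) ∧ gram Φ F = 0 := by
  refine and_congr_right fun _ => ?_
  rw [← gram_conjTranspose, Matrix.conjTranspose_eq_zero]
  constructor
  · intro h
    ext i j
    exact h j i
  · intro h i j
    exact congrFun (congrFun h j) i

theorem horizontal_subset_stiefelTangent : horizontal V Φ ⊆ stiefelTangent V Φ := by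
  intro F hF
  obtain ⟨hV, h⟩ := mem_horizontal_iff.1 hF
  refine mem_stiefelTangent_iff.2 ⟨hV, ?_⟩
  rw [← gram_conjTranspose, h]
  simp

theorem rmul_mem {m n : Type} [Fintype m] {X : m → ℝ → ℂ} (hX : ∀ i, X i ∈ V) (A : Matrix m n ℂ)
    (j : n) : rmul X A j ∈ V := by
  have : rmul X A j = ∑ i, A i j • X i := by
    funext t
    simp [rmul, mul_comm]
  rw [this]
  exact V.sum_mem fun i _ => V.smul_mem _ (hX i)

end Frames

/-! ### The explicit solution of the geodesic equation -/

section ExpPath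

variable {V : Submodule ℂ (ℝ → ℂ)} {Φ F : Pair}

/-- The generator of the linear system that governs a geodesic with initial data `(Φ, F)` and its
velocity, in a frame that rotates with `exp (u Φ*F)`. -/
def geodesicGenerator (Φ F : Pair) : Matrix (Fin 2 ⊕ Fin 2) (Fin 2 ⊕ Fin 2) ℂ :=
  Matrix.fromBlocks (gram Φ F) (-gram F F) 1 (gram Φ F)

/-- The first block column of the identity. -/
def firstBlock : Matrix (Fin 2 ⊕ Fin 2) (Fin 2) ℂ := Matrix.fromRows 1 0

/-- The second block column of the identity. -/
def secondBlock : Matrix (Fin 2 ⊕ Fin 2) (Fin 2) ℂ := Matrix.fromRows 0 1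

/-- The velocity of `expPath Φ F`. -/
def expVelocity (Φ F : Pair) (u : ℝ) : Pair :=
  rmul (Sum.elim Φ F)
    (matrixFlow (geodesicGenerator Φ F) u * secondBlock * matrixFlow (-gram Φ F) u)

theorem expPath_eq (Φ F : Pair) (u : ℝ) : expPath Φ F u = rmul (Sum.elim Φ F)
    (matrixFlow (geodesicGenerator Φ F) u * firstBlock * matrixFlow (-gram Φ F) u) := by
  rw [expPath, neg_smul, ← smul_neg]
  rfl

theorem geodesicGenerator_mul_firstBlock (Φ F : Pair) :
    geodesicGenerator Φ F * firstBlock = firstBlock * gram Φ F + secondBlock := by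
  ext i j
  rcases i with i | i <;>
    simp [geodesicGenerator, firstBlock, secondBlock, Matrix.mul_apply, Matrix.one_apply]

theorem geodesicGenerator_mul_secondBlock (Φ F : Pair) :
    geodesicGenerator Φ F * secondBlock = secondBlock * gram Φ F - firstBlock * gram F F := by
  ext i j
  rcases i with i | i <;>
    simp [geodesicGenerator, firstBlock, secondBlock, Matrix.mul_apply, Matrix.one_apply]

theorem hasVelocityAt_const_rmul {m n : Type} [Fintype m] (X : m → ℝ → ℂ) {A : ℝ → Matrix m n ℂ}
    {A' : Matrix m n ℂ} {u : ℝ} (hA : HasEntryDerivAt A A' u) :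
    HasVelocityAt (fun v => rmul X (A v)) (rmul X A') u := by
  simpa [rmul, HasVelocityAt] using (hasVelocityAt_const X).rmul hA

theorem rmul_sumElim_firstBlock (Φ F : Pair) : rmul (Sum.elim Φ F) firstBlock = Φ := by
  funext j t
  simp [rmul, firstBlock, Matrix.one_apply]

theorem rmul_sumElim_secondBlock (Φ F : Pair) : rmul (Sum.elim Φ F) secondBlock = F := by
  funext j t
  simp [rmul, secondBlock, Matrix.one_apply]

theorem expPath_zero (Φ F : Pair) : expPath Φ F 0 = Φ := by
  rw [expPath_eq, matrixFlow_zero, matrixFlow_zero, Matrix.one_mul, Matrix.mul_one,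
    rmul_sumElim_firstBlock]

theorem expVelocity_zero (Φ F : Pair) : expVelocity Φ F 0 = F := by
  rw [expVelocity, matrixFlow_zero, matrixFlow_zero, Matrix.one_mul, Matrix.mul_one,
    rmul_sumElim_secondBlock]

theorem hasVelocityAt_expPath (Φ F : Pair) (u : ℝ) :
    HasVelocityAt (expPath Φ F) (expVelocity Φ F u) u := by
  have h := hasVelocityAt_const_rmul (Sum.elim Φ F)
    (((hasEntryDerivAt_matrixFlow (geodesicGenerator Φ F) u).mul
      (hasEntryDerivAt_const firstBlock)).mul (hasEntryDerivAt_matrixFlow (-gram Φ F) u))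
  have h2 : (matrixFlow (geodesicGenerator Φ F) u * geodesicGenerator Φ F * firstBlock +
        matrixFlow (geodesicGenerator Φ F) u * (0 : Matrix (Fin 2 ⊕ Fin 2) (Fin 2) ℂ)) * matrixFlow (-gram Φ F) u +
      matrixFlow (geodesicGenerator Φ F) u * firstBlock *
        (matrixFlow (-gram Φ F) u * -gram Φ F) =
      matrixFlow (geodesicGenerator Φ F) u * secondBlock * matrixFlow (-gram Φ F) u := by
    rw [matrixFlow_mul_comm (-gram Φ F), Matrix.mul_assoc _ (geodesicGenerator Φ F),
      geodesicGenerator_mul_firstBlock]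
    simp only [Matrix.mul_add, Matrix.add_mul, Matrix.mul_zero, add_zero, Matrix.neg_mul,
      Matrix.mul_neg, Matrix.mul_assoc]
    abel
  rw [h2] at h
  exact h.congr (Eventually.of_forall fun v => expPath_eq Φ F v)

/-- The explicit path has the acceleration `-expPath Φ F u * (exp (u Φ*F) F*F exp (-u Φ*F))`. -/
theorem hasVelocityAt_expVelocity (Φ F : Pair) (u : ℝ) :
    HasVelocityAt (expVelocity Φ F) (-rmul (expPath Φ F u)
      (matrixFlow (gram Φ F) u * gram F F * matrixFlow (-gram Φ F) u)) u := by
  have h := hasVelocityAt_const_rmul (Sum.elim Φ F)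
    (((hasEntryDerivAt_matrixFlow (geodesicGenerator Φ F) u).mul
      (hasEntryDerivAt_const secondBlock)).mul (hasEntryDerivAt_matrixFlow (-gram Φ F) u))
  have h2 : (matrixFlow (geodesicGenerator Φ F) u * geodesicGenerator Φ F * secondBlock +
        matrixFlow (geodesicGenerator Φ F) u * (0 : Matrix (Fin 2 ⊕ Fin 2) (Fin 2) ℂ)) * matrixFlow (-gram Φ F) u +
      matrixFlow (geodesicGenerator Φ F) u * secondBlock *
        (matrixFlow (-gram Φ F) u * -gram Φ F) =
      -(matrixFlow (geodesicGenerator Φ F) u * firstBlock * matrixFlow (-gram Φ F) u *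
        (matrixFlow (gram Φ F) u * gram F F * matrixFlow (-gram Φ F) u)) := by
    have h3 : matrixFlow (geodesicGenerator Φ F) u * firstBlock * matrixFlow (-gram Φ F) u *
        (matrixFlow (gram Φ F) u * gram F F * matrixFlow (-gram Φ F) u) =
        matrixFlow (geodesicGenerator Φ F) u * firstBlock *
          (matrixFlow (-gram Φ F) u * matrixFlow (gram Φ F) u) *
          (gram F F * matrixFlow (-gram Φ F) u) := by
      simp only [Matrix.mul_assoc]
    rw [h3, matrixFlow_neg_mul, Matrix.mul_one,
      matrixFlow_mul_comm (-gram Φ F), Matrix.mul_assoc _ (geodesicGenerator Φ F),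
      geodesicGenerator_mul_secondBlock]
    simp only [Matrix.mul_sub, Matrix.sub_mul, Matrix.mul_zero, add_zero, Matrix.neg_mul,
      Matrix.mul_neg, Matrix.mul_assoc]
    abel
  rw [h2, rmul_neg, ← rmul_rmul, ← expPath_eq] at h
  exact h

/-- The explicit path with zero initial velocity is constant. So cutting off a tangent field fixes the
endpoints of the variations of `IsSmoothPath.exists_variation`. -/
theorem expPath_zero_right (Φ : Pair) (u : ℝ) : expPath Φ 0 u = Φ := by
  have h0 : gram (0 : Pair) (0 : Pair) = 0 := by
    ext i j
    simp [gram_apply, l2Inner]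
  have h1 : ∀ v, expVelocity Φ 0 v = 0 := by
    intro v
    refine (HasVelocityAt.eq_of_eq_zero (Φ := expVelocity Φ 0) isOpen_univ ordConnected_univ
      (fun w _ => ?_) (mem_univ v) (mem_univ 0)).trans (expVelocity_zero Φ 0)
    have := hasVelocityAt_expVelocity Φ 0 w
    rwa [h0, Matrix.mul_zero, Matrix.zero_mul, rmul_zero, neg_zero] at this
  refine (HasVelocityAt.eq_of_eq_zero (Φ := expPath Φ 0) isOpen_univ ordConnected_univ
    (fun w _ => ?_) (mem_univ u) (mem_univ 0)).trans (expPath_zero Φ 0)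
  have := hasVelocityAt_expPath Φ 0 w
  rwa [h1] at this

theorem expPath_mem {W : Submodule ℂ (ℝ → ℂ)} (hΦ : ∀ i, Φ i ∈ W) (hF : ∀ i, F i ∈ W) (u : ℝ)
    (i : Fin 2) : expPath Φ F u i ∈ W := by
  rw [expPath_eq]
  exact rmul_mem (by rintro (i | i); exacts [hΦ i, hF i]) _ i

theorem expVelocity_mem {W : Submodule ℂ (ℝ → ℂ)} (hΦ : ∀ i, Φ i ∈ W) (hF : ∀ i, F i ∈ W) (u : ℝ)
    (i : Fin 2) : expVelocity Φ F u i ∈ W :=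
  rmul_mem (by rintro (i | i); exacts [hΦ i, hF i]) _ i

theorem gram_sumElim (Φ F : Pair) : gram (Sum.elim Φ F) (Sum.elim Φ F) =
    Matrix.fromBlocks (gram Φ Φ) (gram Φ F) (gram F Φ) (gram F F) := by
  ext (i | i) (j | j) <;> rfl

/-- The generator is skew for the Gram matrix of the initial data. -/
theorem geodesicGenerator_skew (hΦ : gram Φ Φ = 1) (hF : gram F Φ = -gram Φ F) :
    (geodesicGenerator Φ F)ᴴ * gram (Sum.elim Φ F) (Sum.elim Φ F) +
      gram (Sum.elim Φ F) (Sum.elim Φ F) * geodesicGenerator Φ F = 0 := by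
  have hA : (gram Φ F)ᴴ = -gram Φ F := by rw [gram_conjTranspose, hF]
  rw [gram_sumElim, hΦ, hF, geodesicGenerator, Matrix.fromBlocks_conjTranspose]
  simp only [Matrix.conjTranspose_neg, gram_conjTranspose, hF, Matrix.conjTranspose_one,
    Matrix.fromBlocks_multiply, Matrix.fromBlocks_add]
  rw [← Matrix.fromBlocks_zero]
  congr 1 <;> noncomm_ring

/-- The inner products among the position and the velocity of the explicit path evolve by
conjugation with `exp (u Φ*F)`. -/
theorem gram_rmul_flow (hc : ∀ i, Continuous (Φ i)) (hc' : ∀ i, Continuous (F i))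
    (hΦ : gram Φ Φ = 1) (hF : gram F Φ = -gram Φ F) (u : ℝ)
    (J K : Matrix (Fin 2 ⊕ Fin 2) (Fin 2) ℂ) :
    gram (rmul (Sum.elim Φ F) (matrixFlow (geodesicGenerator Φ F) u * J *
        matrixFlow (-gram Φ F) u))
      (rmul (Sum.elim Φ F) (matrixFlow (geodesicGenerator Φ F) u * K *
        matrixFlow (-gram Φ F) u)) =
    matrixFlow (gram Φ F) u * (Jᴴ * gram (Sum.elim Φ F) (Sum.elim Φ F) * K) *
      matrixFlow (-gram Φ F) u := by
  have hX : ∀ i, Continuous (Sum.elim Φ F i) := by rintro (i | i); exacts [hc i, hc' i]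
  rw [gram_rmul_right (fun i => continuous_rmul hX _ i) hX, gram_rmul_left hX hX]
  have h := matrixFlow_preserves (geodesicGenerator_skew hΦ hF) u
  have hA : (-gram Φ F)ᴴ = gram Φ F := by
    rw [Matrix.conjTranspose_neg, gram_conjTranspose, hF, neg_neg]
  simp only [Matrix.conjTranspose_mul, matrixFlow_conjTranspose (-gram Φ F), hA]
  conv_rhs => rw [← h]
  simp only [Matrix.mul_assoc]

theorem gram_expPath (hc : ∀ i, Continuous (Φ i)) (hc' : ∀ i, Continuous (F i))
    (hΦ : gram Φ Φ = 1) (hF : gram F Φ = -gram Φ F) (u : ℝ) :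
    gram (expPath Φ F u) (expPath Φ F u) = 1 := by
  have h : firstBlockᴴ * gram (Sum.elim Φ F) (Sum.elim Φ F) * firstBlock = gram Φ Φ := by
    rw [gram_sumElim]
    ext i j
    simp [firstBlock, Matrix.mul_apply, Matrix.one_apply]
  rw [expPath_eq, gram_rmul_flow hc hc' hΦ hF, h, hΦ, Matrix.mul_one, matrixFlow_mul_neg]

theorem gram_expPath_expVelocity (hc : ∀ i, Continuous (Φ i)) (hc' : ∀ i, Continuous (F i))
    (hΦ : gram Φ Φ = 1) (hF : gram F Φ = -gram Φ F) (u : ℝ) :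
    gram (expPath Φ F u) (expVelocity Φ F u) = gram Φ F := by
  have h : firstBlockᴴ * gram (Sum.elim Φ F) (Sum.elim Φ F) * secondBlock = gram Φ F := by
    rw [gram_sumElim]
    ext i j
    simp [firstBlock, secondBlock, Matrix.mul_apply, Matrix.one_apply]
  rw [expPath_eq, expVelocity, gram_rmul_flow hc hc' hΦ hF, h, matrixFlow_mul_comm,
    Matrix.mul_assoc, matrixFlow_mul_neg, Matrix.mul_one]

theorem gram_expVelocity (hc : ∀ i, Continuous (Φ i)) (hc' : ∀ i, Continuous (F i))
    (hΦ : gram Φ Φ = 1) (hF : gram F Φ = -gram Φ F) (u : ℝ) :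
    gram (expVelocity Φ F u) (expVelocity Φ F u) =
      matrixFlow (gram Φ F) u * gram F F * matrixFlow (-gram Φ F) u := by
  have h : secondBlockᴴ * gram (Sum.elim Φ F) (Sum.elim Φ F) * secondBlock = gram F F := by
    rw [gram_sumElim]
    ext i j
    simp [secondBlock, Matrix.mul_apply, Matrix.one_apply]
  rw [expVelocity, gram_rmul_flow hc hc' hΦ hF, h]

theorem JointSmoothOn.expPath {E : Type} [NormedAddCommGroup E] [NormedSpace ℝ E] {O : Set E}
    (hO : IsOpen O) {X Y : E → Pair} (hX : JointSmoothOn O X) (hY : JointSmoothOn O Y) {σ : E → ℝ}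
    (hσ : ContDiffOn ℝ ∞ σ O) : JointSmoothOn O (fun x => expPath (X x) (Y x) (σ x)) := by
  have hσ' : ContDiffOn ℝ ∞ (fun x => (σ x : ℂ)) O := Complex.ofRealCLM.contDiff.comp_contDiffOn hσ
  have hA := JointSmoothOn.gram hO hX hY
  have hS := JointSmoothOn.gram hO hY hY
  have hM : EntrySmoothOn O (fun x => geodesicGenerator (X x) (Y x)) := by
    rintro (i | i) (j | j)
    exacts [hA i j, (hS i j).neg, contDiffOn_const, hA i j]
  have h := (hX.sumElim hY).rmul ((((hM.smul hσ').exp).mul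
    (entrySmoothOn_const firstBlock)).mul ((hA.neg.smul hσ').exp))
  exact h.congr fun x _ => expPath_eq _ _ _

theorem jointSmoothOn_const {E : Type} [NormedAddCommGroup E] [NormedSpace ℝ E] {O : Set E}
    {X : Pair} (hX : ∀ i, ContDiff ℝ ∞ (X i)) : JointSmoothOn O (fun _ => X) := fun i =>
  ((hX i).comp contDiff_snd).contDiffOn

end ExpPath

/-! ### Spaces of twisted loops -/

section TwistedLoops

variable {V : Submodule ℂ (ℝ → ℂ)}

/-- `V` consists of the smooth functions that satisfy `f (t + 2) = ε f t` for a fixed `ε ≠ 0`. Loops and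
antiloops are the cases `ε = 1` and `ε = -1`. -/
def IsTwistedLoopSpace (V : Submodule ℂ (ℝ → ℂ)) : Prop :=
  ∃ ε : ℂ, ε ≠ 0 ∧ ∀ f, f ∈ V ↔ ContDiff ℝ ∞ f ∧ ∀ t, f (t + 2) = ε * f t

theorem isTwistedLoopSpace_of_eq (hV : V = loopSpace ∨ V = antiloopSpace) :
    IsTwistedLoopSpace V := by
  rcases hV with rfl | rfl
  · exact ⟨1, one_ne_zero, fun f => by simp only [one_mul]; rfl⟩
  · exact ⟨-1, by simp, fun f => by simp only [neg_one_mul]; rfl⟩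

theorem l2Inner_self (f : ℝ → ℂ) :
    l2Inner f f = ((∫ t in (0 : ℝ)..2, ‖f t‖ ^ 2 : ℝ) : ℂ) := by
  rw [← intervalIntegral.integral_ofReal]
  exact intervalIntegral.integral_congr fun t _ => by
    simp [Complex.mul_conj, Complex.normSq_eq_norm_sq]

namespace IsTwistedLoopSpace

theorem contDiff (hV : IsTwistedLoopSpace V) {f : ℝ → ℂ} (hf : f ∈ V) : ContDiff ℝ ∞ f := by
  obtain ⟨ε, -, h⟩ := hV
  exact ((h f).1 hf).1

theorem continuous (hV : IsTwistedLoopSpace V) {f : ℝ → ℂ} (hf : f ∈ V) : Continuous f :=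
  (hV.contDiff hf).continuous

theorem velocity_mem (hV : IsTwistedLoopSpace V) {I : Set ℝ} (hI : IsOpen I) {Φ : ℝ → Pair}
    (hΦ : JointSmoothOn I Φ) (hmem : ∀ u ∈ I, ∀ i, Φ u i ∈ V) {u : ℝ} (hu : u ∈ I) (i : Fin 2) :
    velocity Φ u i ∈ V := by
  obtain ⟨ε, -, h⟩ := hV
  refine (h _).2 ⟨(hΦ.velocity hI).contDiff hu i, fun t => ?_⟩
  refine (hΦ.hasVelocityAt hI hu i (t + 2)).unique ?_
  refine ((hΦ.hasVelocityAt hI hu i t).const_mul ε).congr_of_eventuallyEq ?_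
  filter_upwards [hI.mem_nhds hu] with v hv
  exact ((h _).1 (hmem v hv i)).2 t

theorem eq_zero_of_l2Inner_self (hV : IsTwistedLoopSpace V) {f : ℝ → ℂ} (hf : f ∈ V)
    (h0 : (l2Inner f f).re = 0) : f = 0 := by
  obtain ⟨ε, hε, h⟩ := hV
  obtain ⟨hc, hper⟩ := (h f).1 hf
  rw [l2Inner_self, Complex.ofReal_re] at h0
  have hzero : ∀ t ∈ Icc (0 : ℝ) 2, f t = 0 := by
    by_contra! hne
    obtain ⟨t, ht, hft⟩ := hne
    have := intervalIntegral.integral_pos (f := fun t => ‖f t‖ ^ 2) (a := 0) (b := 2) two_pos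
      (hc.continuous.norm.pow 2).continuousOn (fun _ _ => by positivity)
      ⟨t, ht, by positivity⟩
    exact this.ne' h0
  have hP : Function.Periodic (fun t => f t = 0) 2 := fun t => by
    simp [hper t, hε]
  funext t
  obtain ⟨y, hy, hty⟩ := hP.exists_mem_Ico₀ two_pos t
  exact hty.mpr (hzero y ⟨hy.1, hy.2.le⟩)

end IsTwistedLoopSpace

theorem gL2_self_eq (F : Pair) :
    gL2 F F = ∑ i, ∫ t in (0 : ℝ)..2, ‖F i t‖ ^ 2 := by
  simp only [gL2, l2Inner_self, Complex.re_sum, Complex.ofReal_re]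

theorem gL2_self_nonneg (F : Pair) : 0 ≤ gL2 F F := by
  rw [gL2_self_eq]
  exact Finset.sum_nonneg fun i _ =>
    intervalIntegral.integral_nonneg two_pos.le fun t _ => by positivity

/-- The form `gL2` is definite on `V`, since a twisted loop is determined by its values on `[0, 2]`. -/
theorem IsTwistedLoopSpace.eq_zero_of_gL2_self (hV : IsTwistedLoopSpace V) {F : Pair}
    (hF : ∀ i, F i ∈ V) (h0 : gL2 F F = 0) : F = 0 := by
  rw [gL2_self_eq, Finset.sum_eq_zero_iff_of_nonneg fun i _ =>
    intervalIntegral.integral_nonneg two_pos.le fun t _ => by positivity] at h0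
  funext i
  refine hV.eq_zero_of_l2Inner_self (hF i) ?_
  rw [l2Inner_self, Complex.ofReal_re]
  exact h0 i (Finset.mem_univ i)

theorem IsTwistedLoopSpace.eq_zero_of_gram_self (hV : IsTwistedLoopSpace V) {F : Pair}
    (hF : ∀ i, F i ∈ V) (h0 : gram F F = 0) : F = 0 :=
  hV.eq_zero_of_gL2_self hF (by rw [gL2_eq_re_trace, h0]; simp)

end TwistedLoops

/-! ### Paths of frames and the geodesic equation -/

section StiefelPaths

variable {V : Submodule ℂ (ℝ → ℂ)} {I : Set ℝ} {Φ : ℝ → Pair} {u : ℝ}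

theorem IsSmoothPath.jointSmoothOn (h : IsSmoothPath V I Φ) : JointSmoothOn I Φ := h.1

theorem IsSmoothPath.gram_self (h : IsSmoothPath V I Φ) (hu : u ∈ I) : gram (Φ u) (Φ u) = 1 :=
  (mem_stiefel_iff.1 (h.2 u hu)).2

theorem IsSmoothPath.mem (h : IsSmoothPath V I Φ) (hu : u ∈ I) (i : Fin 2) : Φ u i ∈ V :=
  (h.2 u hu).1 i

theorem IsSmoothPath.velocity_mem_stiefelTangent (hV : IsTwistedLoopSpace V) (hI : IsOpen I)
    (h : IsSmoothPath V I Φ) (hu : u ∈ I) : velocity Φ u ∈ stiefelTangent V (Φ u) := by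
  refine mem_stiefelTangent_iff.2
    ⟨hV.velocity_mem hI h.jointSmoothOn (fun v hv => h.mem hv) hu, ?_⟩
  have h1 := h.jointSmoothOn.hasEntryDerivAt_gram hI h.jointSmoothOn hu
  have h2 : HasEntryDerivAt (fun v => gram (Φ v) (Φ v)) 0 u :=
    (hasEntryDerivAt_const 1).congr (by
      filter_upwards [hI.mem_nhds hu] with v hv
      exact h.gram_self hv)
  exact eq_neg_of_add_eq_zero_left (h1.unique h2)

theorem rmul_geodesicGenerator (X Y Φ F : Pair) :
    rmul (Sum.elim X Y) (geodesicGenerator Φ F) =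
      Sum.elim (rmul X (gram Φ F) + Y) (rmul Y (gram Φ F) - rmul X (gram F F)) := by
  funext i t
  rcases i with i | i
  · simp [rmul, geodesicGenerator, Matrix.one_apply]
  · simp only [rmul, geodesicGenerator, Fintype.sum_sum_type, Sum.elim_inl, Sum.elim_inr,
      Matrix.fromBlocks_apply₁₂, Matrix.fromBlocks_apply₂₂, Matrix.neg_apply, mul_neg,
      Finset.sum_neg_distrib, Pi.sub_apply]
    ring

/-- A path that solves the geodesic equation is the explicit path with the same initial data: `Φ*Φ'` is
constant, `Φ'*Φ'` evolves by conjugation with `exp (u Φ*Φ')`, and so `(Φ, Φ') exp (u Φ*Φ')` solves a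
linear system with constant coefficients. -/
theorem IsSmoothPath.eq_expPath (hV : IsTwistedLoopSpace V) (hI : IsOpen I) (hI' : I.OrdConnected)
    (h0 : (0 : ℝ) ∈ I) (h : IsSmoothPath V I Φ)
    (hgeo : ∀ u ∈ I, acceleration Φ u +
      rmul (Φ u) (adj (velocity Φ u) (velocity Φ u)) = 0) (hu : u ∈ I) :
    Φ u = expPath (Φ 0) (velocity Φ 0) u := by
  have hs := h.jointSmoothOn
  have hs' := hs.velocity hI
  have hacc : ∀ v ∈ I, velocity (velocity Φ) v =
      -rmul (Φ v) (gram (velocity Φ v) (velocity Φ v)) := fun v hv =>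
    eq_neg_of_add_eq_zero_left (hgeo v hv)
  have hc : ∀ v ∈ I, ∀ i, Continuous (Φ v i) := fun v hv => hs.continuous hv
  have hc' : ∀ v ∈ I, ∀ i, Continuous (velocity Φ v i) := fun v hv => hs'.continuous hv
  have hskew : ∀ v ∈ I, gram (velocity Φ v) (Φ v) = -gram (Φ v) (velocity Φ v) := fun v hv =>
    (mem_stiefelTangent_iff.1 (h.velocity_mem_stiefelTangent hV hI hv)).2
  set A := gram (Φ 0) (velocity Φ 0) with hA
  set S := gram (velocity Φ 0) (velocity Φ 0) with hS
  -- `Φ*Φ'` is constant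
  have hAconst : ∀ v ∈ I, gram (Φ v) (velocity Φ v) = A := by
    intro v hv
    refine HasEntryDerivAt.eq_of_eq_zero (A := fun v => gram (Φ v) (velocity Φ v)) hI hI'
      (fun w hw => ?_) hv h0
    have := hs.hasEntryDerivAt_gram hI hs' hw
    rwa [hacc w hw, gram_neg_right, gram_rmul_right (hc w hw) (hc w hw), h.gram_self hw,
      Matrix.one_mul, add_neg_cancel] at this
  -- `Φ'*Φ'` evolves by conjugation
  have hSconj : ∀ v ∈ I, matrixFlow (-A) v * gram (velocity Φ v) (velocity Φ v) * matrixFlow A v =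
      S := by
    intro v hv
    have key : ∀ w ∈ I, HasEntryDerivAt (fun v => matrixFlow (-A) v *
        gram (velocity Φ v) (velocity Φ v) * matrixFlow A v) 0 w := by
      intro w hw
      have h1 := hs'.hasEntryDerivAt_gram hI hs' hw
      rw [hacc w hw, gram_neg_right, gram_neg_left, gram_rmul_right (hc' w hw) (hc w hw),
        gram_rmul_left (hc w hw) (hc' w hw), hskew w hw, hAconst w hw, gram_conjTranspose] at h1
      have h2 := ((hasEntryDerivAt_matrixFlow (-A) w).mul h1).mul (hasEntryDerivAt_matrixFlow A w)
      convert h2 using 1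
      rw [matrixFlow_mul_comm A]
      noncomm_ring
    have := HasEntryDerivAt.eq_of_eq_zero hI hI' key hv h0
    simpa [matrixFlow_zero] using this
  -- the linear system
  have hlin : ∀ w ∈ I, HasVelocityAt
      (fun v => rmul (Sum.elim (rmul (Φ v) (matrixFlow A v)) (rmul (velocity Φ v) (matrixFlow A v)))
        (matrixFlow (-geodesicGenerator (Φ 0) (velocity Φ 0)) v)) 0 w := by
    intro w hw
    have hX : HasVelocityAt
        (fun v => Sum.elim (rmul (Φ v) (matrixFlow A v)) (rmul (velocity Φ v) (matrixFlow A v)))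
        (rmul (Sum.elim (rmul (Φ w) (matrixFlow A w)) (rmul (velocity Φ w) (matrixFlow A w)))
          (geodesicGenerator (Φ 0) (velocity Φ 0))) w := by
      have hcomm : gram (velocity Φ w) (velocity Φ w) * matrixFlow A w = matrixFlow A w * S := by
        rw [← hSconj w hw, ← Matrix.mul_assoc, ← Matrix.mul_assoc, matrixFlow_mul_neg,
          Matrix.one_mul]
      have h1 := (hs.hasVelocityAt hI hw).rmul (hasEntryDerivAt_matrixFlow A w)
      have h2 := (hs'.hasVelocityAt hI hw).rmul (hasEntryDerivAt_matrixFlow A w)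
      rw [hacc w hw, neg_rmul, rmul_rmul, hcomm] at h2
      rw [rmul_geodesicGenerator, ← hA, ← hS]
      rintro (i | i) t
      · rw [← rmul_rmul, add_comm] at h1
        exact h1 i t
      · rw [← rmul_rmul, ← rmul_rmul, neg_add_eq_sub] at h2
        exact h2 i t
    have h3 := hX.rmul (hasEntryDerivAt_matrixFlow (-geodesicGenerator (Φ 0) (velocity Φ 0)) w)
    rwa [rmul_rmul, ← rmul_add, matrixFlow_mul_comm, Matrix.neg_mul, add_neg_cancel, rmul_zero]
      at h3
  have hconst := HasVelocityAt.eq_of_eq_zero hI hI' hlin hu h0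
  simp only [matrixFlow_zero, rmul_one'] at hconst
  rw [expPath_eq, ← hconst, rmul_rmul, ← hA, Matrix.mul_assoc, ← Matrix.mul_assoc,
    matrixFlow_neg_mul, Matrix.one_mul, ← rmul_rmul, rmul_sumElim_firstBlock, rmul_rmul,
    matrixFlow_mul_neg, rmul_one']

theorem velocity_expPath (Φ F : Pair) : velocity (expPath Φ F) = expVelocity Φ F :=
  funext fun u => (hasVelocityAt_expPath Φ F u).velocity_eq

theorem expPath_mem_stiefel (hV : IsTwistedLoopSpace V) {Φ F : Pair} (hΦ : Φ ∈ stiefel V)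
    (hF : F ∈ stiefelTangent V Φ) (u : ℝ) : expPath Φ F u ∈ stiefel V := by
  rw [mem_stiefel_iff] at hΦ ⊢
  rw [mem_stiefelTangent_iff] at hF
  exact ⟨expPath_mem hΦ.1 hF.1 u, gram_expPath (fun i => hV.continuous (hΦ.1 i))
    (fun i => hV.continuous (hF.1 i)) hΦ.2 hF.2 u⟩

theorem isSmoothPath_expPath (hV : IsTwistedLoopSpace V) {Φ F : Pair} (hΦ : Φ ∈ stiefel V)
    (hF : F ∈ stiefelTangent V Φ) : IsSmoothPath V univ (expPath Φ F) :=
  ⟨JointSmoothOn.expPath (X := fun _ => Φ) (Y := fun _ => F) (σ := fun u => u) isOpen_univ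
    (jointSmoothOn_const fun i => hV.contDiff (hΦ.1 i))
    (jointSmoothOn_const fun i => hV.contDiff (hF.1 i)) contDiffOn_id,
    fun u _ => expPath_mem_stiefel hV hΦ hF u⟩

theorem acceleration_expPath (hV : IsTwistedLoopSpace V) {Φ F : Pair} (hΦ : Φ ∈ stiefel V)
    (hF : F ∈ stiefelTangent V Φ) (u : ℝ) : acceleration (expPath Φ F) u +
      rmul (expPath Φ F u) (adj (velocity (expPath Φ F) u) (velocity (expPath Φ F) u)) = 0 := by
  rw [mem_stiefel_iff] at hΦ
  rw [mem_stiefelTangent_iff] at hF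
  rw [adj_eq_gram, acceleration, velocity_expPath, (hasVelocityAt_expVelocity Φ F u).velocity_eq,
    gram_expVelocity (fun i => hV.continuous (hΦ.1 i))
    (fun i => hV.continuous (hF.1 i)) hΦ.2 hF.2, neg_add_cancel]

end StiefelPaths

/-! ### The first variation of the energy -/

section FirstVariation

variable {V : Submodule ℂ (ℝ → ℂ)} {I : Set ℝ} {Φ Ψ : ℝ → Pair} {a b u : ℝ}

theorem gL2_comm (F G : Pair) : gL2 F G = gL2 G F := by
  rw [gL2_eq_re_trace, gL2_eq_re_trace, ← gram_conjTranspose, Matrix.trace_conjTranspose]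
  simp

theorem gL2_neg_right (F G : Pair) : gL2 F (-G) = -gL2 F G := by
  rw [gL2_eq_re_trace, gram_neg_left, Matrix.trace_neg, Complex.neg_re, gL2_eq_re_trace]

theorem gL2_zero_left (G : Pair) : gL2 0 G = 0 := by
  have h := gram_smul_right G (0 : Pair) 0
  rw [zero_smul, zero_smul] at h
  rw [gL2_eq_re_trace, h]
  simp

theorem gL2_ofReal_smul_left (F G : Pair) (c : ℝ) : gL2 ((c : ℂ) • F) G = c * gL2 F G := by
  rw [gL2_eq_re_trace, gram_smul_right, Matrix.trace_smul, gL2_eq_re_trace]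
  simp

theorem gL2_sub_left {F F' G : Pair} (hF : ∀ i, Continuous (F i)) (hF' : ∀ i, Continuous (F' i))
    (hG : ∀ i, Continuous (G i)) : gL2 (F - F') G = gL2 F G - gL2 F' G := by
  rw [gL2_eq_re_trace, gram_sub_right hG hF hF', Matrix.trace_sub, Complex.sub_re]
  rfl

theorem gL2_sub_right {F G G' : Pair} (hF : ∀ i, Continuous (F i)) (hG : ∀ i, Continuous (G i))
    (hG' : ∀ i, Continuous (G' i)) : gL2 F (G - G') = gL2 F G - gL2 F G' := by
  rw [gL2_comm, gL2_sub_left hG hG' hF, gL2_comm G, gL2_comm G']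

theorem JointSmoothOn.gL2 {E : Type} [NormedAddCommGroup E] [NormedSpace ℝ E] {O : Set E}
    (hO : IsOpen O) {X Y : E → Pair} (hX : JointSmoothOn O X) (hY : JointSmoothOn O Y) :
    ContDiffOn ℝ ∞ (fun x => gL2 (X x) (Y x)) O :=
  Complex.reCLM.contDiff.comp_contDiffOn
    (f := fun x => ∑ i : Fin 2, FramedLoop.gram (Y x) (X x) i i)
    (ContDiffOn.sum fun i _ => JointSmoothOn.gram hO hY hX i i)

theorem JointSmoothOn.hasDerivAt_gL2 (hI : IsOpen I) (hΦ : JointSmoothOn I Φ)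
    (hΨ : JointSmoothOn I Ψ) (hu : u ∈ I) :
    HasDerivAt (fun v => FramedLoop.gL2 (Φ v) (Ψ v))
      (FramedLoop.gL2 (FramedLoop.velocity Φ u) (Ψ u) +
        FramedLoop.gL2 (Φ u) (FramedLoop.velocity Ψ u)) u := by
  have h := HasDerivAt.fun_sum fun i (_ : i ∈ Finset.univ) =>
    hΨ.hasEntryDerivAt_gram hI hΦ hu i i
  have h2 := Complex.reCLM.hasFDerivAt.comp_hasDerivAt u h
  refine h2.congr_deriv ?_
  simp only [Matrix.add_apply, Finset.sum_add_distrib, map_add]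
  exact add_comm _ _

/-- Differentiation under the integral sign for the integral of a squared norm. -/
theorem hasDerivAt_half_integral_gL2 (hI : IsOpen I) {X : ℝ → ℝ → Pair} (hX : FamilySmoothOn I X)
    (hab : uIcc a b ⊆ I) :
    HasDerivAt (fun s => (1 / 2) * ∫ u in a..b, gL2 (X s u) (X s u))
      (∫ u in a..b, gL2 (velocity (fun r => X r u) 0) (X 0 u)) 0 := by
  have h := (hasDerivAt_integral_param isOpen_univ hI hab
    (JointSmoothOn.gL2 (isOpen_univ.prod hI) hX hX) (mem_univ 0)).const_mul (1 / 2 : ℝ)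
  refine h.congr_deriv ?_
  rw [← intervalIntegral.integral_const_mul]
  refine intervalIntegral.integral_congr fun u hu => ?_
  have h1 := ((hX.left (hab hu)).hasDerivAt_gL2 isOpen_univ (hX.left (hab hu)) (mem_univ 0)).deriv
  simp only [] at h1 ⊢
  rw [h1, gL2_comm (X 0 u)]
  ring

theorem integral_gL2_velocity_left (hI : IsOpen I) (hΦ : JointSmoothOn I Φ)
    (hΨ : JointSmoothOn I Ψ) (hab : uIcc a b ⊆ I) :
    ∫ u in a..b, gL2 (velocity Φ u) (Ψ u) =
      gL2 (Φ b) (Ψ b) - gL2 (Φ a) (Ψ a) - ∫ u in a..b, gL2 (Φ u) (velocity Ψ u) := by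
  have h1 : ContinuousOn (fun u => gL2 (velocity Φ u) (Ψ u)) (uIcc a b) :=
    ((JointSmoothOn.gL2 hI (hΦ.velocity hI) hΨ).continuousOn).mono hab
  have h2 : ContinuousOn (fun u => gL2 (Φ u) (velocity Ψ u)) (uIcc a b) :=
    ((JointSmoothOn.gL2 hI hΦ (hΨ.velocity hI)).continuousOn).mono hab
  have h3 := intervalIntegral.integral_eq_sub_of_hasDerivAt
    (fun u hu => hΦ.hasDerivAt_gL2 hI hΨ (hab hu)) (h1.add h2).intervalIntegrable
  rw [intervalIntegral.integral_add h1.intervalIntegrable h2.intervalIntegrable] at h3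
  linarith

/-- A tangent vector at `Φ` is orthogonal to `Φ C` for all Hermitian matrices `C`. -/
theorem gL2_rmul_eq_zero {Φ F : Pair} {C : Matrix (Fin 2) (Fin 2) ℂ}
    (hΦ : ∀ i, Continuous (Φ i)) (hF : ∀ i, Continuous (F i)) (hC : Cᴴ = C)
    (h : gram F Φ = -gram Φ F) : gL2 F (rmul Φ C) = 0 := by
  rw [gL2_eq_re_trace, gram_rmul_left hΦ hF, hC]
  exact re_trace_mul_eq_zero hC (by rw [gram_conjTranspose, h])

theorem isSmoothFamily_iff {Ψ : ℝ → ℝ → Pair} : IsSmoothFamily V I Ψ ↔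
    FamilySmoothOn I Ψ ∧ ∀ s, ∀ u ∈ I, Ψ s u ∈ stiefel V := by
  rw [familySmoothOn_iff, IsSmoothFamily]

theorem IsSmoothFamily.right {Ψ : ℝ → ℝ → Pair} (h : IsSmoothFamily V I Ψ) (s : ℝ) :
    IsSmoothPath V I (Ψ s) :=
  ⟨(isSmoothFamily_iff.1 h).1.right s, h.2 s⟩

theorem IsSmoothFamily.left {Ψ : ℝ → ℝ → Pair} (h : IsSmoothFamily V I Ψ) (hu : u ∈ I) :
    IsSmoothPath V univ (fun s => Ψ s u) :=
  ⟨(isSmoothFamily_iff.1 h).1.left hu, fun s _ => h.2 s u hu⟩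

/-- The first variation of the energy of a path in the Stiefel manifold. -/
theorem IsSmoothFamily.hasDerivAt_energy (hI : IsOpen I) {Ψ : ℝ → ℝ → Pair}
    (h : IsSmoothFamily V I Ψ) (hab : uIcc a b ⊆ I) :
    HasDerivAt (fun s => energy a b (Ψ s))
      (gL2 (velocity (fun s => Ψ s b) 0) (velocity (Ψ 0) b) -
        gL2 (velocity (fun s => Ψ s a) 0) (velocity (Ψ 0) a) -
        ∫ u in a..b, gL2 (velocity (fun s => Ψ s u) 0) (acceleration (Ψ 0) u)) 0 := by
  have hF := (isSmoothFamily_iff.1 h).1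
  refine (hasDerivAt_half_integral_gL2 hI (hF.velocity_right hI) hab).congr_deriv ?_
  rw [acceleration, ← integral_gL2_velocity_left (Φ := fun u => velocity (fun s => Ψ s u) 0) hI
    ((hF.velocity_left hI).right 0) ((hF.right 0).velocity hI) hab]
  exact intervalIntegral.integral_congr fun u hu => by simp only [hF.velocity_comm hI (hab hu)]

/-- Every tangent field along a path of frames, cut off by a polynomial that vanishes at `a` and `b`,
is the variation field of a smooth family of paths of frames with fixed values at `a` and `b`. The
family consists of the explicit paths with the given initial velocities. -/
theorem IsSmoothPath.exists_variation (hV : IsTwistedLoopSpace V) (hI : IsOpen I)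
    (h : IsSmoothPath V I Φ) {D : ℝ → Pair} (hD : JointSmoothOn I D)
    (hDT : ∀ u ∈ I, D u ∈ stiefelTangent V (Φ u)) (a b : ℝ) :
    ∃ Ψ : ℝ → ℝ → Pair, IsSmoothFamily V I Ψ ∧ Ψ 0 = Φ ∧ (∀ s, Ψ s a = Φ a) ∧
      (∀ s, Ψ s b = Φ b) ∧ ∀ u, velocity (fun s => Ψ s u) 0 =
        (((u - a) * (b - u) : ℝ) : ℂ) • D u := by
  refine ⟨fun s u => expPath (Φ u) ((((u - a) * (b - u) : ℝ) : ℂ) • D u) s, ?_, ?_, ?_, ?_, ?_⟩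
  · refine isSmoothFamily_iff.2 ⟨?_, fun s u hu => ?_⟩
    · have hO : IsOpen ((univ : Set ℝ) ×ˢ I) := isOpen_univ.prod hI
      have hsnd : ContDiffOn ℝ ∞ (fun p : ℝ × ℝ => p.2) (univ ×ˢ I) := contDiffOn_snd
      have hmaps : MapsTo (fun p : ℝ × ℝ => p.2) (univ ×ˢ I) I := fun p hp => hp.2
      exact JointSmoothOn.expPath (X := fun p : ℝ × ℝ => Φ p.2)
        (Y := fun p : ℝ × ℝ => (((p.2 - a) * (b - p.2) : ℝ) : ℂ) • D p.2) (σ := fun p => p.1) hO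
        (h.jointSmoothOn.comp hsnd hmaps)
        ((hD.comp hsnd hmaps).smul (Complex.ofRealCLM.contDiff.comp_contDiffOn
          (f := fun p : ℝ × ℝ => (p.2 - a) * (b - p.2)) (ContDiff.contDiffOn (by fun_prop))))
        contDiffOn_fst
    · refine expPath_mem_stiefel hV (h.2 u hu) ?_ s
      obtain ⟨h1, h2⟩ := mem_stiefelTangent_iff.1 (hDT u hu)
      refine mem_stiefelTangent_iff.2 ⟨fun i => V.smul_mem _ (h1 i), ?_⟩
      rw [gram_smul_left, gram_smul_right, Complex.conj_ofReal, h2, smul_neg]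
  · exact funext fun u => expPath_zero _ _
  · intro s
    simp [expPath_zero_right]
  · intro s
    simp [expPath_zero_right]
  · intro u
    rw [(hasVelocityAt_expPath _ _ 0).velocity_eq, expVelocity_zero]

/-- The fundamental lemma of the calculus of variations for the cut-offs of `exists_variation`. -/
theorem eq_zero_of_integral_cutoff_gL2 (hV : IsTwistedLoopSpace V) (hI : IsOpen I) {D : ℝ → Pair}
    (hD : JointSmoothOn I D) (hDV : ∀ u ∈ I, ∀ i, D u i ∈ V)
    (h : ∀ a b, a < b → Icc a b ⊆ I →
      ∫ u in a..b, (u - a) * (b - u) * gL2 (D u) (D u) = 0) (hu : u ∈ I) : D u = 0 := by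
  obtain ⟨ε, hε, hball⟩ := Metric.isOpen_iff.1 hI u hu
  have hsub : Icc (u - ε / 2) (u + ε / 2) ⊆ I := fun v hv => hball (by
    rw [Metric.mem_ball, Real.dist_eq, abs_lt]
    constructor <;> linarith [hv.1, hv.2])
  have hlt : u - ε / 2 < u + ε / 2 := by linarith
  refine hV.eq_zero_of_gL2_self (hDV u hu) ?_
  by_contra hne
  have hpos : 0 < gL2 (D u) (D u) := lt_of_le_of_ne (gL2_self_nonneg _) (Ne.symm hne)
  have hcont : ContinuousOn (fun v => gL2 (D v) (D v)) (Icc (u - ε / 2) (u + ε / 2)) :=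
    ((JointSmoothOn.gL2 hI hD hD).continuousOn).mono hsub
  refine (intervalIntegral.integral_pos hlt ?_ ?_ ⟨u, ⟨by linarith, by linarith⟩, ?_⟩).ne'
    (h _ _ hlt hsub)
  · exact ContinuousOn.mul (by fun_prop) hcont
  · intro v hv
    exact mul_nonneg (mul_nonneg (by linarith [hv.1]) (by linarith [hv.2])) (gL2_self_nonneg _)
  · exact mul_pos (mul_pos (by linarith) (by linarith)) hpos

/-- The geodesics of the Stiefel manifold are the solutions of the geodesic equation. -/
theorem isGeodesic_iff (hV : IsTwistedLoopSpace V) (hI : IsOpen I) (h : IsSmoothPath V I Φ) :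
    IsGeodesic V I Φ ↔ ∀ u ∈ I, acceleration Φ u +
      rmul (Φ u) (adj (velocity Φ u) (velocity Φ u)) = 0 := by
  have hs := h.jointSmoothOn
  have hs' := hs.velocity hI
  have hs'' := hs'.velocity hI
  constructor
  · rintro ⟨-, hcrit⟩ u hu
    have hD : JointSmoothOn I (fun u => acceleration Φ u +
        rmul (Φ u) (gram (velocity Φ u) (velocity Φ u))) :=
      hs''.add (hs.rmul (JointSmoothOn.gram hI hs' hs'))
    have hDV : ∀ v ∈ I, ∀ i, (acceleration Φ v +
        rmul (Φ v) (gram (velocity Φ v) (velocity Φ v))) i ∈ V := fun v hv i =>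
      V.add_mem (hV.velocity_mem hI hs' (fun w hw =>
        hV.velocity_mem hI hs (fun _ hx => h.mem hx) hw) hv i) (rmul_mem (h.mem hv) _ i)
    -- the tension field is tangent, because `Φ*Φ'' + 2 Φ'*Φ' + Φ''*Φ = 0`
    have hDT : ∀ v ∈ I, acceleration Φ v +
        rmul (Φ v) (gram (velocity Φ v) (velocity Φ v)) ∈ stiefelTangent V (Φ v) := by
      intro v hv
      refine mem_stiefelTangent_iff.2 ⟨hDV v hv, ?_⟩
      have h1 := (hs'.hasEntryDerivAt_gram hI hs hv)
      have h2 := (hs.hasEntryDerivAt_gram hI hs' hv)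
      have h3 : HasEntryDerivAt (fun w => gram (velocity Φ w) (Φ w))
          (-(gram (velocity Φ v) (velocity Φ v) + gram (Φ v) (velocity (velocity Φ) v))) v :=
        HasEntryDerivAt.congr (A := fun w => -gram (Φ w) (velocity Φ w))
          (fun i j => (h2 i j).neg) (by
            filter_upwards [hI.mem_nhds hv] with w hw
            exact (mem_stiefelTangent_iff.1 (h.velocity_mem_stiefelTangent hV hI hw)).2)
      have h4 := h1.unique h3
      have hc := hs.continuous hv
      have hc'' := hs''.continuous hv
      have hcr := continuous_rmul hc (gram (velocity Φ v) (velocity Φ v))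
      rw [acceleration, gram_add_left hc'' hcr hc, gram_add_right hc hc'' hcr,
        gram_rmul_left hc hc, gram_rmul_right hc hc, h.gram_self hv, Matrix.mul_one,
        Matrix.one_mul, gram_conjTranspose, h4]
      abel
    refine eq_zero_of_integral_cutoff_gL2 hV hI hD hDV (fun a b hab hsub => ?_) hu
    obtain ⟨Ψ, hΨ, hΨ0, hΨa, hΨb, hΨv⟩ := h.exists_variation hV hI hD hDT a b
    have hsub' : uIcc a b ⊆ I := by rwa [uIcc_of_le hab.le]
    have h1 := hcrit a b hab hsub Ψ hΨ (fun u _ => by rw [hΨ0]) hΨa hΨb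
    have h2 := h1.unique (hΨ.hasDerivAt_energy hI hsub')
    simp only [hΨv, hΨ0, sub_self, zero_mul, mul_zero, Complex.ofReal_zero, zero_smul,
      gL2_zero_left, zero_sub] at h2
    rw [← neg_eq_zero, h2]
    congr 1
    refine intervalIntegral.integral_congr fun v hv => ?_
    have hv' := hsub' hv
    have h3 := gL2_rmul_eq_zero (hs.continuous hv') (hD.continuous hv')
      (gram_conjTranspose (velocity Φ v) (velocity Φ v)) (mem_stiefelTangent_iff.1 (hDT v hv')).2
    have h4 := gL2_sub_right (hD.continuous hv') (hD.continuous hv')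
      (continuous_rmul (hs.continuous hv') (gram (velocity Φ v) (velocity Φ v)))
    rw [h3, sub_zero, add_sub_cancel_right] at h4
    simp only [gL2_ofReal_smul_left]
    rw [h4]
  · intro hgeo
    refine ⟨h, fun a b hab hsub Ψ hΨ hΨ0 hΨa hΨb => ?_⟩
    have hsub' : uIcc a b ⊆ I := by rwa [uIcc_of_le hab.le]
    refine (hΨ.hasDerivAt_energy hI hsub').congr_deriv ?_
    have hca : velocity (fun s => Ψ s a) 0 = 0 := by
      simp only [hΨa]
      exact (hasVelocityAt_const _).velocity_eq
    have hcb : velocity (fun s => Ψ s b) 0 = 0 := by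
      simp only [hΨb]
      exact (hasVelocityAt_const _).velocity_eq
    have hzero : ∫ u in a..b, gL2 (velocity (fun s => Ψ s u) 0) (acceleration (Ψ 0) u) = 0 := by
      refine (intervalIntegral.integral_congr fun u hu => ?_).trans
        intervalIntegral.integral_zero
      have hu' := hsub' hu
      have hvel : ∀ v ∈ I, velocity (Ψ 0) v = velocity Φ v := fun v hv =>
        ((hs.hasVelocityAt hI hv).congr (by
          filter_upwards [hI.mem_nhds hv] with w hw using hΨ0 w hw)).velocity_eq
      have hacc : acceleration (Ψ 0) u = acceleration Φ u :=
        ((hs'.hasVelocityAt hI hu').congr (by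
          filter_upwards [hI.mem_nhds hu'] with w hw using hvel w hw)).velocity_eq
      have hT := (hΨ.left hu').velocity_mem_stiefelTangent hV isOpen_univ (mem_univ 0)
      obtain ⟨hTV, hTs⟩ := mem_stiefelTangent_iff.1 hT
      simp only [hΨ0 u hu'] at hTs
      have h5 := hgeo u hu'
      rw [adj_eq_gram] at h5
      simp only [hacc, eq_neg_of_add_eq_zero_left h5, gL2_neg_right]
      rw [gL2_rmul_eq_zero (hs.continuous hu') (fun i => hV.continuous (hTV i))
        (gram_conjTranspose _ _) hTs, neg_zero]
    rw [hca, hcb, hzero, gL2_zero_left, gL2_zero_left]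
    ring

end FirstVariation

/-! ### Planes and frames -/

section Planes

variable {V : Submodule ℂ (ℝ → ℂ)} {Φ Ψ : Pair}

theorem plane_rmul_le (Φ : Pair) (A : Matrix (Fin 2) (Fin 2) ℂ) : plane (rmul Φ A) ≤ plane Φ :=
  Submodule.span_le.2 (by
    rintro _ ⟨j, rfl⟩
    exact rmul_mem (fun i => Submodule.subset_span (mem_range_self i)) A j)

theorem plane_rmul_eq (Φ : Pair) {A : Matrix (Fin 2) (Fin 2) ℂ} (hA : A * Aᴴ = 1) :
    plane (rmul Φ A) = plane Φ := by
  refine le_antisymm (plane_rmul_le Φ A) ?_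
  conv_lhs => rw [← rmul_one Φ, ← hA, ← rmul_rmul]
  exact plane_rmul_le _ _

/-- A pair in the plane of an orthonormal frame `Φ` is recovered from its inner products with `Φ`. -/
theorem eq_rmul_gram_of_plane_le (hc : ∀ i, Continuous (Φ i)) (hΦ : gram Φ Φ = 1)
    (h : plane Ψ ≤ plane Φ) : Ψ = rmul Φ (gram Φ Ψ) := by
  have h1 : ∀ j, ∃ a : Fin 2 → ℂ, ∑ i, a i • Φ i = Ψ j := fun j =>
    (Submodule.mem_span_range_iff_exists_fun ℂ).1 (h (Submodule.subset_span (mem_range_self j)))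
  choose a ha using h1
  have h2 : Ψ = rmul Φ (Matrix.of fun i j => a j i) := by
    funext j t
    rw [← ha j]
    simp [rmul, mul_comm]
  conv_rhs => rw [h2, gram_rmul_right hc hc, hΦ, Matrix.one_mul]
  exact h2

theorem plane_mem_grassmannian (hV : IsTwistedLoopSpace V) (hΦ : Φ ∈ stiefel V) :
    plane Φ ∈ grassmannian V := by
  obtain ⟨h1, h2⟩ := mem_stiefel_iff.1 hΦ
  refine ⟨Submodule.span_le.2 (by rintro _ ⟨i, rfl⟩; exact h1 i), ?_⟩
  have hli : LinearIndependent ℂ Φ := by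
    refine Fintype.linearIndependent_iff.2 fun g hg i => ?_
    have hc : ∀ i, Continuous (Φ i) := fun i => hV.continuous (h1 i)
    have h3 := gram_rmul_right hc hc (Matrix.of fun i (_ : Fin 1) => g i)
    have h4 : rmul Φ (Matrix.of fun i (_ : Fin 1) => g i) = 0 := by
      funext j t
      have := congrFun hg t
      simpa [rmul, mul_comm] using this
    rw [h2, Matrix.one_mul, h4] at h3
    have h5 := congrFun (congrFun h3 i) 0
    simpa [gram_apply, l2Inner] using h5.symm
  rw [plane, finrank_span_eq_card hli, Fintype.card_fin]

end Planes

/-! ### The first variation of the energy of paths of planes -/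

section HorizontalVariation

variable {V : Submodule ℂ (ℝ → ℂ)} {I : Set ℝ} {Φ Ψ : ℝ → Pair} {a b u : ℝ}

/-- The horizontal part of the velocity of a path of frames, which represents the velocity of the path
of planes. -/
def horVelocity (Ψ : ℝ → Pair) (u : ℝ) : Pair := horPart (Ψ u) (velocity Ψ u)

/-- The derivative of the horizontal velocity, corrected for the rotation of the frame. -/
def horDeriv (Ψ : ℝ → Pair) (u : ℝ) : Pair :=
  velocity (horVelocity Ψ) u - rmul (horVelocity Ψ u) (gram (Ψ u) (velocity Ψ u))

/-- The tension field of a path of planes, in terms of a lift `Ψ`: the horizontal part of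
`horDeriv Ψ`. -/
def grTension (Ψ : ℝ → Pair) (u : ℝ) : Pair :=
  horDeriv Ψ u + rmul (Ψ u) (gram (horVelocity Ψ u) (horVelocity Ψ u))

theorem JointSmoothOn.horVelocity (hI : IsOpen I) (h : JointSmoothOn I Ψ) :
    JointSmoothOn I (horVelocity Ψ) :=
  (h.velocity hI).sub (h.rmul (JointSmoothOn.gram hI h (h.velocity hI)))

theorem JointSmoothOn.horDeriv (hI : IsOpen I) (h : JointSmoothOn I Ψ) :
    JointSmoothOn I (horDeriv Ψ) :=
  ((h.horVelocity hI).velocity hI).sub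
    ((h.horVelocity hI).rmul (JointSmoothOn.gram hI h (h.velocity hI)))

theorem JointSmoothOn.grTension (hI : IsOpen I) (h : JointSmoothOn I Ψ) :
    JointSmoothOn I (grTension Ψ) :=
  (h.horDeriv hI).add (h.rmul (JointSmoothOn.gram hI (h.horVelocity hI) (h.horVelocity hI)))

theorem velocity_eq_horVelocity_add (Ψ : ℝ → Pair) (u : ℝ) :
    velocity Ψ u = horVelocity Ψ u + rmul (Ψ u) (gram (Ψ u) (velocity Ψ u)) :=
  (sub_add_cancel _ _).symm

theorem IsSmoothPath.gram_horVelocity (hI : IsOpen I) (h : IsSmoothPath V I Ψ) (hu : u ∈ I) :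
    gram (Ψ u) (horVelocity Ψ u) = 0 := by
  have hc := h.jointSmoothOn.continuous hu
  have hc' := (h.jointSmoothOn.velocity hI).continuous hu
  rw [horVelocity, horPart, gram_sub_right hc hc' (continuous_rmul hc _), gram_rmul_right hc hc,
    h.gram_self hu, Matrix.one_mul, adj_eq_gram, sub_self]

theorem IsSmoothPath.gram_horVelocity_left (hI : IsOpen I) (h : IsSmoothPath V I Ψ) (hu : u ∈ I) :
    gram (horVelocity Ψ u) (Ψ u) = 0 := by
  rw [← gram_conjTranspose, h.gram_horVelocity hI hu, Matrix.conjTranspose_zero]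

theorem IsSmoothPath.horVelocity_mem (hV : IsTwistedLoopSpace V) (hI : IsOpen I)
    (h : IsSmoothPath V I Ψ) (hu : u ∈ I) (i : Fin 2) : horVelocity Ψ u i ∈ V :=
  V.sub_mem ((h.velocity_mem_stiefelTangent hV hI hu).1 i) (rmul_mem (h.mem hu) _ i)

theorem IsSmoothPath.conjTranspose_connection (hV : IsTwistedLoopSpace V) (hI : IsOpen I)
    (h : IsSmoothPath V I Ψ) (hu : u ∈ I) :
    (gram (Ψ u) (velocity Ψ u))ᴴ = -gram (Ψ u) (velocity Ψ u) := by
  rw [gram_conjTranspose]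
  exact (mem_stiefelTangent_iff.1 (h.velocity_mem_stiefelTangent hV hI hu)).2

theorem IsSmoothPath.grTension_mem_horizontal (hV : IsTwistedLoopSpace V) (hI : IsOpen I)
    (h : IsSmoothPath V I Ψ) (hu : u ∈ I) : grTension Ψ u ∈ horizontal V (Ψ u) := by
  have hs := h.jointSmoothOn
  have hP := hs.horVelocity hI
  have hc := hs.continuous hu
  have hcP := hP.continuous hu
  have hcP' := (hP.velocity hI).continuous hu
  refine mem_horizontal_iff.2 ⟨fun i => V.add_mem (V.sub_mem
    (hV.velocity_mem hI hP (fun v hv => h.horVelocity_mem hV hI hv) hu i)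
    (rmul_mem (h.horVelocity_mem hV hI hu) _ i)) (rmul_mem (h.mem hu) _ i), ?_⟩
  have h1 := (hs.hasEntryDerivAt_gram hI hP hu).unique
    ((hasEntryDerivAt_const 0).congr (by
      filter_upwards [hI.mem_nhds hu] with v hv using h.gram_horVelocity hI hv))
  rw [velocity_eq_horVelocity_add Ψ u, gram_add_left hcP (continuous_rmul hc _) hcP,
    gram_rmul_left hc hcP, h.gram_horVelocity hI hu, Matrix.mul_zero, add_zero] at h1
  rw [grTension, horDeriv, gram_add_right hc
    (continuous_sub_row hcP' (continuous_rmul hcP _)) (continuous_rmul hc _),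
    gram_sub_right hc hcP' (continuous_rmul hcP _), gram_rmul_right hc hcP,
    gram_rmul_right hc hc, h.gram_self hu, h.gram_horVelocity hI hu, Matrix.zero_mul,
    Matrix.one_mul, sub_zero, add_comm, h1]

/-- The first variation of the energy of a path of planes, in terms of lifts. -/
theorem IsSmoothFamily.hasDerivAt_horEnergy (hV : IsTwistedLoopSpace V) (hI : IsOpen I)
    {Ψ : ℝ → ℝ → Pair} (h : IsSmoothFamily V I Ψ) (hab : uIcc a b ⊆ I) :
    HasDerivAt (fun s => horEnergy a b (Ψ s))
      (gL2 (velocity (fun s => Ψ s b) 0) (horVelocity (Ψ 0) b) -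
        gL2 (velocity (fun s => Ψ s a) 0) (horVelocity (Ψ 0) a) -
        ∫ u in a..b, gL2 (velocity (fun s => Ψ s u) 0) (horDeriv (Ψ 0) u)) 0 := by
  have hF := (isSmoothFamily_iff.1 h).1
  have hO : IsOpen ((univ : Set ℝ) ×ˢ I) := isOpen_univ.prod hI
  have hX : FamilySmoothOn I (fun s u => horVelocity (Ψ s) u) :=
    JointSmoothOn.sub (hF.velocity_right hI)
      (JointSmoothOn.rmul hF (JointSmoothOn.gram hO hF (hF.velocity_right hI)))
  have hY := (hF.velocity_left hI).right 0
  have hP := (hF.right 0).horVelocity hI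
  refine (hasDerivAt_half_integral_gL2 hI hX hab).congr_deriv ?_
  have hparts := integral_gL2_velocity_left hI hY hP hab
  have hcont : ∀ {f : ℝ → ℝ}, ContDiffOn ℝ ∞ f I → IntervalIntegrable f volume a b :=
    fun hf => (hf.continuousOn.mono hab).intervalIntegrable
  have hPB := hP.rmul (JointSmoothOn.gram hI (hF.right 0) ((hF.right 0).velocity hI))
  have hsplit : ∫ u in a..b, gL2 (velocity (fun s => Ψ s u) 0) (horDeriv (Ψ 0) u) =
      (∫ u in a..b, gL2 (velocity (fun s => Ψ s u) 0) (velocity (horVelocity (Ψ 0)) u)) -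
      ∫ u in a..b, gL2 (velocity (fun s => Ψ s u) 0) (rmul (horVelocity (Ψ 0) u)
        (gram (Ψ 0 u) (velocity (Ψ 0) u))) := by
    rw [← intervalIntegral.integral_sub (hcont (JointSmoothOn.gL2 hI hY (hP.velocity hI)))
      (hcont (JointSmoothOn.gL2 hI hY hPB))]
    refine intervalIntegral.integral_congr fun u hu => ?_
    have hu' := hab hu
    exact gL2_sub_right (hY.continuous hu') ((hP.velocity hI).continuous hu')
      (hPB.continuous hu')
  rw [hsplit, ← sub_add, ← hparts, ← intervalIntegral.integral_add
    (hcont (JointSmoothOn.gL2 hI (hY.velocity hI) hP)) (hcont (JointSmoothOn.gL2 hI hY hPB))]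
  refine intervalIntegral.integral_congr fun u hu => ?_
  have hu' := hab hu
  have hB := (hF.left hu').hasEntryDerivAt_gram isOpen_univ
    ((hF.velocity_right hI).left hu') (mem_univ 0)
  have hXv := ((((hF.velocity_right hI).left hu').hasVelocityAt isOpen_univ (mem_univ 0)).sub
    (((hF.left hu').hasVelocityAt isOpen_univ (mem_univ 0)).rmul hB)).velocity_eq
  rw [hF.velocity_comm hI hu'] at hXv
  have hcΨ := (hF.right 0).continuous hu'
  have hcY := hY.continuous hu'
  have hcY' := (hY.velocity hI).continuous hu'
  have hcP := hP.continuous hu'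
  have hpath := h.right 0
  change gL2 (velocity (fun s => velocity (Ψ s) u - rmul (Ψ s u)
    (gram (Ψ s u) (velocity (Ψ s) u))) 0) (horVelocity (Ψ 0) u) = _
  rw [hXv, gL2_sub_left hcY' (continuous_add_row (continuous_rmul hcY _) (continuous_rmul hcΨ _))
    hcP, sub_eq_add_neg]
  congr 1
  rw [gL2_eq_re_trace, gL2_eq_re_trace, gram_add_right hcP (continuous_rmul hcY _)
    (continuous_rmul hcΨ _), gram_rmul_right hcP hcY, gram_rmul_right hcP hcΨ,
    hpath.gram_horVelocity_left hI hu', Matrix.zero_mul, add_zero, gram_rmul_left hcP hcY,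
    hpath.conjTranspose_connection hV hI hu', Matrix.neg_mul, Matrix.trace_neg, Complex.neg_re,
    Matrix.trace_mul_comm]

/-- The tension field does not depend on the choice of the lift, up to the rotation of the frame. -/
theorem grTension_of_plane_eq (hI : IsOpen I) (hΦ : IsSmoothPath V I Φ)
    (hΨ : IsSmoothPath V I Ψ) (h : ∀ u ∈ I, plane (Ψ u) = plane (Φ u)) (hu : u ∈ I) :
    grTension Ψ u = rmul (grTension Φ u) (gram (Φ u) (Ψ u)) := by
  have hsΦ := hΦ.jointSmoothOn
  have hsΨ := hΨ.jointSmoothOn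
  set U : ℝ → Matrix (Fin 2) (Fin 2) ℂ := fun v => gram (Φ v) (Ψ v) with hU
  have hrep : ∀ v ∈ I, Ψ v = rmul (Φ v) (U v) := fun v hv =>
    eq_rmul_gram_of_plane_le (hsΦ.continuous hv) (hΦ.gram_self hv) (h v hv).le
  have hunit : ∀ v ∈ I, U v * (U v)ᴴ = 1 := by
    intro v hv
    rw [mul_eq_one_comm, ← hΨ.gram_self hv]
    conv_rhs => rw [hrep v hv]
    have hc := hsΦ.continuous hv
    rw [gram_rmul_left hc (continuous_rmul hc _), gram_rmul_right hc hc, hΦ.gram_self hv,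
      Matrix.one_mul]
  have hUder : ∀ v ∈ I, ∃ U', HasEntryDerivAt U U' v := fun v hv =>
    ⟨_, hsΦ.hasEntryDerivAt_gram hI hsΨ hv⟩
  have hvel : ∀ v ∈ I, ∀ U', HasEntryDerivAt U U' v →
      velocity Ψ v = rmul (velocity Φ v) (U v) + rmul (Φ v) U' := fun v hv U' hU' =>
    (((hsΦ.hasVelocityAt hI hv).rmul hU').congr (by
      filter_upwards [hI.mem_nhds hv] with w hw using hrep w hw)).velocity_eq
  have hconn : ∀ v ∈ I, ∀ U', HasEntryDerivAt U U' v →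
      U v * gram (Ψ v) (velocity Ψ v) = gram (Φ v) (velocity Φ v) * U v + U' := by
    intro v hv U' hU'
    have hc := hsΦ.continuous hv
    have hc' := (hsΦ.velocity hI).continuous hv
    rw [hvel v hv U' hU', hrep v hv, gram_rmul_left hc
      (continuous_add_row (continuous_rmul hc' _) (continuous_rmul hc _)), ← Matrix.mul_assoc,
      hunit v hv, Matrix.one_mul, gram_add_right hc (continuous_rmul hc' _) (continuous_rmul hc _),
      gram_rmul_right hc hc', gram_rmul_right hc hc, hΦ.gram_self hv, Matrix.one_mul]
  have hhor : ∀ v ∈ I, horVelocity Ψ v = rmul (horVelocity Φ v) (U v) := by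
    intro v hv
    obtain ⟨U', hU'⟩ := hUder v hv
    have h1 : rmul (Ψ v) (gram (Ψ v) (velocity Ψ v)) =
        rmul (Φ v) (gram (Φ v) (velocity Φ v) * U v + U') := by
      rw [← hconn v hv U' hU', ← rmul_rmul, ← hrep v hv]
    rw [horVelocity, horPart, adj_eq_gram, h1, hvel v hv U' hU', horVelocity, horPart, sub_rmul,
      rmul_rmul, rmul_add, adj_eq_gram]
    abel
  obtain ⟨U', hU'⟩ := hUder u hu
  have hder : horDeriv Ψ u = rmul (horDeriv Φ u) (U u) := by
    have h1 : velocity (horVelocity Ψ) u =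
        rmul (velocity (horVelocity Φ) u) (U u) + rmul (horVelocity Φ u) U' :=
      ((((hsΦ.horVelocity hI).hasVelocityAt hI hu).rmul hU').congr (by
        filter_upwards [hI.mem_nhds hu] with w hw using hhor w hw)).velocity_eq
    rw [horDeriv, h1, hhor u hu, rmul_rmul, hconn u hu U' hU', horDeriv, sub_rmul, rmul_rmul,
      rmul_add]
    abel
  have hcP := (hsΦ.horVelocity hI).continuous hu
  rw [grTension, hder, grTension, add_rmul, hhor u hu, gram_rmul_left hcP (continuous_rmul hcP _),
    gram_rmul_right hcP hcP]
  conv_lhs => rw [hrep u hu]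
  rw [rmul_rmul, rmul_rmul, ← Matrix.mul_assoc, hunit u hu, Matrix.one_mul]

/-- A path of planes is a geodesic if and only if the tension field of a lift vanishes. -/
theorem isGrGeodesic_iff (hV : IsTwistedLoopSpace V) (hI : IsOpen I)
    {c : ℝ → Submodule ℂ (ℝ → ℂ)} (hΦ : IsLift V I c Φ) :
    IsGrGeodesic V I c ↔ ∀ u ∈ I, grTension Φ u = 0 := by
  obtain ⟨hΦ, hplane⟩ := hΦ
  have hs := hΦ.jointSmoothOn
  constructor
  · rintro ⟨-, hcrit⟩ u hu
    have hD := hs.grTension hI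
    have hDH := fun v (hv : v ∈ I) => hΦ.grTension_mem_horizontal hV hI hv
    refine eq_zero_of_integral_cutoff_gL2 hV hI hD (fun v hv => (hDH v hv).1)
      (fun a b hab hsub => ?_) hu
    obtain ⟨Ψ, hΨ, hΨ0, hΨa, hΨb, hΨv⟩ := hΦ.exists_variation hV hI hD
      (fun v hv => horizontal_subset_stiefelTangent (hDH v hv)) a b
    have hsub' : uIcc a b ⊆ I := by rwa [uIcc_of_le hab.le]
    have h1 := hcrit a b hab hsub Ψ hΨ (fun u hu => by rw [hΨ0, hplane u hu])
      (fun s => by rw [hΨa, hplane a (hsub ⟨le_rfl, hab.le⟩)])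
      (fun s => by rw [hΨb, hplane b (hsub ⟨hab.le, le_rfl⟩)])
    have h2 := h1.unique (hΨ.hasDerivAt_horEnergy hV hI hsub')
    simp only [hΨv, hΨ0, sub_self, zero_mul, mul_zero, Complex.ofReal_zero, zero_smul,
      gL2_zero_left, zero_sub] at h2
    rw [← neg_eq_zero, h2]
    congr 1
    refine intervalIntegral.integral_congr fun v hv => ?_
    have hv' := hsub' hv
    have hT := horizontal_subset_stiefelTangent (hDH v hv')
    have h3 := gL2_rmul_eq_zero (hs.continuous hv') (hD.continuous hv')
      (gram_conjTranspose (horVelocity Φ v) (horVelocity Φ v)) (mem_stiefelTangent_iff.1 hT).2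
    have h4 := gL2_sub_right (hD.continuous hv') (hD.continuous hv')
      (continuous_rmul (hs.continuous hv') (gram (horVelocity Φ v) (horVelocity Φ v)))
    have h5 : grTension Φ v - rmul (Φ v) (gram (horVelocity Φ v) (horVelocity Φ v)) =
        horDeriv Φ v := add_sub_cancel_right _ _
    rw [h3, sub_zero, h5] at h4
    simp only [gL2_ofReal_smul_left]
    rw [h4]
  · intro hgeo
    refine ⟨⟨Φ, hΦ, hplane⟩, fun a b hab hsub Ψ hΨ hΨ0 hΨa hΨb => ?_⟩
    have hsub' : uIcc a b ⊆ I := by rwa [uIcc_of_le hab.le]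
    refine (hΨ.hasDerivAt_horEnergy hV hI hsub').congr_deriv ?_
    have hpath := hΨ.right 0
    -- at an endpoint the variation field lies in the fixed plane
    have hend : ∀ v ∈ I, (∀ s, plane (Ψ s v) = c v) →
        gL2 (velocity (fun s => Ψ s v) 0) (horVelocity (Ψ 0) v) = 0 := by
      intro v hv hfix
      have hsv := (hΨ.left hv).jointSmoothOn
      have hP := (hpath.jointSmoothOn.horVelocity hI)
      have hconst : JointSmoothOn univ (fun _ : ℝ => horVelocity (Ψ 0) v) :=
        jointSmoothOn_const (hP.contDiff hv)
      have hc := hpath.jointSmoothOn.continuous hv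
      have h1 : ∀ s, gram (horVelocity (Ψ 0) v) (Ψ s v) = 0 := by
        intro s
        rw [eq_rmul_gram_of_plane_le hc (hpath.gram_self hv) ((hfix s).trans (hΨ0 v hv).symm).le,
          gram_rmul_right (hP.continuous hv) hc, hpath.gram_horVelocity_left hI hv,
          Matrix.zero_mul]
      have h2 := (hconst.hasEntryDerivAt_gram isOpen_univ hsv (mem_univ 0)).unique
        ((hasEntryDerivAt_const 0).congr (Eventually.of_forall h1))
      have h3 : gram (velocity (fun _ : ℝ => horVelocity (Ψ 0) v) 0) (Ψ 0 v) = 0 := by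
        rw [(hasVelocityAt_const _).velocity_eq]
        simpa using gram_smul_left (0 : Pair) (Ψ 0 v) 0
      rw [h3, zero_add] at h2
      rw [gL2_eq_re_trace, h2]
      simp
    have hzero : ∫ u in a..b, gL2 (velocity (fun s => Ψ s u) 0) (horDeriv (Ψ 0) u) = 0 := by
      refine (intervalIntegral.integral_congr fun u hu => ?_).trans
        intervalIntegral.integral_zero
      have hu' := hsub' hu
      have h1 := grTension_of_plane_eq hI hΦ hpath
        (fun v hv => (hΨ0 v hv).trans (hplane v hv).symm) hu'
      have h2 : rmul (0 : Pair) (gram (Φ u) (Ψ 0 u)) = 0 := by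
        funext j t
        simp [rmul]
      rw [hgeo u hu', h2, grTension] at h1
      obtain ⟨hTV, hTs⟩ := mem_stiefelTangent_iff.1
        ((hΨ.left hu').velocity_mem_stiefelTangent hV isOpen_univ (mem_univ 0))
      simp only [eq_neg_of_add_eq_zero_left h1, gL2_neg_right]
      rw [gL2_rmul_eq_zero (hpath.jointSmoothOn.continuous hu') (fun i => hV.continuous (hTV i))
        (gram_conjTranspose _ _) hTs, neg_zero]
    rw [hend a (hsub ⟨le_rfl, hab.le⟩) hΨa, hend b (hsub ⟨hab.le, le_rfl⟩) hΨb, hzero]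
    ring

end HorizontalVariation

/-! ### Uniqueness of geodesics in the Grassmannian -/

section Uniqueness

variable {V : Submodule ℂ (ℝ → ℂ)} {I : Set ℝ} {Φ Ψ : ℝ → Pair} {a b u : ℝ}

/-- The skew-Hermitian operator `P Ψ* - Ψ P*`, for `P` the horizontal velocity of `Ψ`, applied to a
pair `f`. In terms of the orthogonal projection `p` onto the plane `[Ψ]` this is the commutator
`[p', p]`. -/
def momentum (Ψ : ℝ → Pair) (u : ℝ) (f : Pair) : Pair :=
  rmul (horVelocity Ψ u) (gram (Ψ u) f) - rmul (Ψ u) (gram (horVelocity Ψ u) f)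

/-- The momentum is conserved along geodesics of the Grassmannian. -/
theorem IsSmoothPath.momentum_eq (hV : IsTwistedLoopSpace V) (hI : IsOpen I) (hI' : I.OrdConnected)
    (h : IsSmoothPath V I Ψ) (hgeo : ∀ u ∈ I, grTension Ψ u = 0) {f : Pair}
    (hf : ∀ i, ContDiff ℝ ∞ (f i)) {u v : ℝ} (hu : u ∈ I) (hv : v ∈ I) :
    momentum Ψ u f = momentum Ψ v f := by
  refine HasVelocityAt.eq_of_eq_zero (Φ := fun u => momentum Ψ u f) hI hI' (fun w hw => ?_) hu hv
  have hs := h.jointSmoothOn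
  have hP := hs.horVelocity hI
  have hfs : JointSmoothOn I (fun _ : ℝ => f) := jointSmoothOn_const hf
  have hcf := fun i => (hf i).continuous
  have hc := hs.continuous hw
  have hcP := hP.continuous hw
  have h1 := ((hP.hasVelocityAt hI hw).rmul (hs.hasEntryDerivAt_gram hI hfs hw)).sub
    ((hs.hasVelocityAt hI hw).rmul (hP.hasEntryDerivAt_gram hI hfs hw))
  have hzero : ∀ Φ : Pair, gram Φ (0 : Pair) = 0 := fun Φ => by
    simpa using gram_smul_right Φ (0 : Pair) 0
  have hP' : velocity (horVelocity Ψ) w = rmul (horVelocity Ψ w) (gram (Ψ w) (velocity Ψ w)) -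
      rmul (Ψ w) (gram (horVelocity Ψ w) (horVelocity Ψ w)) := by
    have h2 := hgeo w hw
    rw [grTension, horDeriv] at h2
    rw [← sub_eq_zero, ← h2]
    abel
  set B := gram (Ψ w) (velocity Ψ w) with hB
  have hBs : Bᴴ = -B := h.conjTranspose_connection hV hI hw
  have hΨ' : velocity Ψ w = horVelocity Ψ w + rmul (Ψ w) B := velocity_eq_horVelocity_add Ψ w
  rw [(hasVelocityAt_const f).velocity_eq, hzero, hzero, add_zero, add_zero, hP', hΨ',
    gram_add_left hcP (continuous_rmul hc _) hcf, gram_rmul_left hc hcf, hBs,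
    gram_sub_left (continuous_rmul hcP _) (continuous_rmul hc _) hcf, gram_rmul_left hcP hcf, hBs,
    gram_rmul_left hc hcf, gram_conjTranspose] at h1
  refine h1.congr_velocity ?_
  simp only [sub_rmul, add_rmul, rmul_add, rmul_sub, rmul_rmul, Matrix.neg_mul, rmul_neg]
  abel

/-- Two geodesics of planes with lifts `Φ` and `Ψ`, the first one horizontal, agree if they have the
same initial velocity: both `Φ` and the horizontal part of `Ψ` move by the conserved momentum, which
makes `Φ*Ψ` unitary at all times. -/
theorem plane_eq_of_grTension_eq_zero (hV : IsTwistedLoopSpace V) (hI : IsOpen I)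
    (hI' : I.OrdConnected) (h0 : (0 : ℝ) ∈ I) (hΦ : IsSmoothPath V I Φ) (hΨ : IsSmoothPath V I Ψ)
    (hgeoΦ : ∀ u ∈ I, grTension Φ u = 0) (hgeoΨ : ∀ u ∈ I, grTension Ψ u = 0)
    (hhor : ∀ u ∈ I, gram (Φ u) (velocity Φ u) = 0)
    {U : Matrix (Fin 2) (Fin 2) ℂ} (hU : U * Uᴴ = 1) (hinit : Φ 0 = rmul (Ψ 0) U)
    (hinit' : horVelocity Φ 0 = rmul (horVelocity Ψ 0) U) (hu : u ∈ I) :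
    plane (Ψ u) = plane (Φ u) := by
  have hsΦ := hΦ.jointSmoothOn
  have hsΨ := hΨ.jointSmoothOn
  have hPΦ := hsΦ.horVelocity hI
  have hPΨ := hsΨ.horVelocity hI
  have hmom : ∀ v ∈ I, horVelocity Ψ v = momentum Φ v (Ψ v) := by
    intro v hv
    have hf := hsΨ.contDiff hv
    have hcf := fun i => (hf i).continuous
    have h1 : momentum Ψ v (Ψ v) = horVelocity Ψ v := by
      rw [momentum, hΨ.gram_self hv, hΨ.gram_horVelocity_left hI hv, rmul_one', rmul_zero,
        sub_zero]
    rw [← h1, hΨ.momentum_eq hV hI hI' hgeoΨ hf hv h0, hΦ.momentum_eq hV hI hI' hgeoΦ hf hv h0,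
      momentum, momentum, hinit, hinit', gram_rmul_left (hsΨ.continuous h0) hcf,
      gram_rmul_left (hPΨ.continuous h0) hcf, rmul_rmul, rmul_rmul, ← Matrix.mul_assoc,
      ← Matrix.mul_assoc, hU, Matrix.one_mul, Matrix.one_mul]
  have hvelΦ : ∀ v ∈ I, velocity Φ v = horVelocity Φ v := by
    intro v hv
    rw [horVelocity, horPart, adj_eq_gram, hhor v hv, rmul_zero, sub_zero]
  have hder : ∀ v ∈ I, HasEntryDerivAt (fun w => gram (Φ w) (Ψ w))
      (gram (Φ v) (Ψ v) * gram (Ψ v) (velocity Ψ v)) v := by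
    intro v hv
    have h1 := hsΦ.hasEntryDerivAt_gram hI hsΨ hv
    have hc := hsΦ.continuous hv
    have hcP := hPΦ.continuous hv
    have hcΨ := hsΨ.continuous hv
    have hcPΨ := hPΨ.continuous hv
    have h2 : gram (Φ v) (velocity Ψ v) = -gram (velocity Φ v) (Ψ v) +
        gram (Φ v) (Ψ v) * gram (Ψ v) (velocity Ψ v) := by
      conv_lhs => rw [velocity_eq_horVelocity_add Ψ v]
      rw [gram_add_right hc hcPΨ (continuous_rmul hcΨ _), gram_rmul_right hc hcΨ, hmom v hv,
        momentum, gram_sub_right hc (continuous_rmul hcP _) (continuous_rmul hc _),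
        gram_rmul_right hc hcP, gram_rmul_right hc hc, hΦ.gram_self hv,
        hΦ.gram_horVelocity hI hv, Matrix.zero_mul, Matrix.one_mul, zero_sub, hvelΦ v hv]
    rwa [h2, add_neg_cancel_left] at h1
  have hunit : ∀ v ∈ I, gram (Φ v) (Ψ v) * (gram (Φ v) (Ψ v))ᴴ = 1 := by
    intro v hv
    have hc0 := hsΨ.continuous h0
    have hK0 : gram (Φ 0) (Ψ 0) = Uᴴ := by
      rw [hinit, gram_rmul_left hc0 hc0, hΨ.gram_self h0, Matrix.mul_one]
    have h1 : gram (Φ 0) (Ψ 0) * (gram (Φ 0) (Ψ 0))ᴴ = 1 := by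
      rw [hK0, Matrix.conjTranspose_conjTranspose]
      exact mul_eq_one_comm.1 hU
    rw [← h1]
    refine HasEntryDerivAt.eq_of_eq_zero
      (A := fun v => gram (Φ v) (Ψ v) * (gram (Φ v) (Ψ v))ᴴ) hI hI' (fun w hw => ?_) hv h0
    have h2 := (hder w hw).mul (hder w hw).conjTranspose
    rwa [Matrix.conjTranspose_mul, hΨ.conjTranspose_connection hV hI hw, Matrix.neg_mul,
      Matrix.mul_neg, ← Matrix.mul_assoc, add_neg_cancel] at h2
  have hrep : Ψ u = rmul (Φ u) (gram (Φ u) (Ψ u)) := by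
    have hc := hsΦ.continuous hu
    have hcΨ := hsΨ.continuous hu
    have hcr := continuous_rmul hc (gram (Φ u) (Ψ u))
    refine sub_eq_zero.1 (hV.eq_zero_of_gram_self
      (fun i => V.sub_mem (hΨ.mem hu i) (rmul_mem (hΦ.mem hu) _ i)) ?_)
    rw [gram_sub_right (continuous_sub_row hcΨ hcr) hcΨ hcr, gram_sub_left hcΨ hcr hcΨ,
      gram_sub_left hcΨ hcr hcr, gram_rmul_right hcΨ hc, gram_rmul_left hc hcΨ,
      gram_rmul_left hc hcr, gram_rmul_right hc hc, hΨ.gram_self hu, hΦ.gram_self hu,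
      ← gram_conjTranspose (Φ u) (Ψ u), Matrix.one_mul, mul_eq_one_comm.1 (hunit u hu)]
    simp
  rw [hrep, plane_rmul_eq _ (hunit u hu)]

end Uniqueness

/-! ### The geodesics of the Grassmannian -/

section GrassmannianGeodesics

variable {V : Submodule ℂ (ℝ → ℂ)} {I : Set ℝ}

theorem HorVec.vec_mem_stiefelTangent (x : HorVec V) : x.vec ∈ stiefelTangent V x.frame :=
  horizontal_subset_stiefelTangent x.vec_mem

theorem HorVec.gram_frame_vec (x : HorVec V) : gram x.frame x.vec = 0 :=
  (mem_horizontal_iff.1 x.vec_mem).2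

theorem HorVec.isSmoothPath (hV : IsTwistedLoopSpace V) (x : HorVec V) :
    IsSmoothPath V univ (expPath x.frame x.vec) :=
  isSmoothPath_expPath hV x.frame_mem x.vec_mem_stiefelTangent

theorem HorVec.velocity_mem_horizontal (hV : IsTwistedLoopSpace V) (x : HorVec V) (u : ℝ) :
    velocity (expPath x.frame x.vec) u ∈ horizontal V (expPath x.frame x.vec u) := by
  have hΦ := mem_stiefel_iff.1 x.frame_mem
  have hF := mem_stiefelTangent_iff.1 x.vec_mem_stiefelTangent
  refine mem_horizontal_iff.2 ⟨?_, ?_⟩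
  · rw [velocity_expPath]
    exact expVelocity_mem hΦ.1 hF.1 u
  · rw [velocity_expPath, gram_expPath_expVelocity (fun i => hV.continuous (hΦ.1 i))
      (fun i => hV.continuous (hF.1 i)) hΦ.2 hF.2, x.gram_frame_vec]

theorem HorVec.horVelocity_eq (hV : IsTwistedLoopSpace V) (x : HorVec V) (u : ℝ) :
    horVelocity (expPath x.frame x.vec) u = velocity (expPath x.frame x.vec) u := by
  rw [horVelocity, horPart, adj_eq_gram,
    (mem_horizontal_iff.1 (x.velocity_mem_horizontal hV u)).2, rmul_zero, sub_zero]

theorem HorVec.grTension_eq_zero (hV : IsTwistedLoopSpace V) (x : HorVec V) (u : ℝ) :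
    grTension (expPath x.frame x.vec) u = 0 := by
  have h1 : horVelocity (expPath x.frame x.vec) = velocity (expPath x.frame x.vec) :=
    funext (x.horVelocity_eq hV)
  have h2 := acceleration_expPath hV x.frame_mem x.vec_mem_stiefelTangent u
  rw [grTension, horDeriv, h1, (mem_horizontal_iff.1 (x.velocity_mem_horizontal hV u)).2,
    rmul_zero, sub_zero]
  exact h2

theorem HorVec.isLift (hV : IsTwistedLoopSpace V) (x : HorVec V) :
    IsLift V univ (fun u => plane (expPath x.frame x.vec u)) (expPath x.frame x.vec) :=
  ⟨x.isSmoothPath hV, fun _ _ => rfl⟩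

theorem HorVec.isGrGeodesic (hV : IsTwistedLoopSpace V) (x : HorVec V) :
    IsGrGeodesic V univ (fun u => plane (expPath x.frame x.vec u)) :=
  (isGrGeodesic_iff hV isOpen_univ (x.isLift hV)).2 fun u _ => x.grTension_eq_zero hV u

theorem HorVec.hasInitialVelocity (hV : IsTwistedLoopSpace V) (x : HorVec V) :
    HasInitialVelocity V univ (fun u => plane (expPath x.frame x.vec u)) x.toGr := by
  refine ⟨expPath x.frame x.vec, x, x.isLift hV, rfl, (expPath_zero _ _).symm, ?_⟩
  have h := x.horVelocity_eq hV 0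
  rw [velocity_expPath, expVelocity_zero] at h
  exact h.symm

/-- Uniqueness of geodesics of planes. The initial velocity may be given by another representative of
the tangent vector, hence the unitary matrix `U`. -/
theorem HorVec.eq_plane_expPath (hV : IsTwistedLoopSpace V) (x : HorVec V) (hI : IsOpen I)
    (hI' : I.OrdConnected) (h0 : (0 : ℝ) ∈ I) {c : ℝ → Submodule ℂ (ℝ → ℂ)}
    (hc : IsGrGeodesic V I c) (hc' : HasInitialVelocity V I c x.toGr) {u : ℝ} (hu : u ∈ I) :
    c u = plane (expPath x.frame x.vec u) := by
  obtain ⟨Ψ, y, hΨ, hyx, hy0, hyv⟩ := hc'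
  obtain ⟨U, hU, hf, hv⟩ : ∃ U ∈ Matrix.unitaryGroup (Fin 2) ℂ,
      x.frame = rmul y.frame U ∧ x.vec = rmul y.vec U := Quotient.exact hyx
  have hx := x.isSmoothPath hV
  rw [← hΨ.2 u hu]
  refine plane_eq_of_grTension_eq_zero hV hI hI' h0
    ⟨fun i => (hx.1 i).mono (prod_mono (subset_univ _) le_rfl), fun v _ => hx.2 v (mem_univ v)⟩
    hΨ.1 (fun v _ => x.grTension_eq_zero hV v) ((isGrGeodesic_iff hV hI hΨ).1 hc)
    (fun v _ => (mem_horizontal_iff.1 (x.velocity_mem_horizontal hV v)).2)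
    (Matrix.mem_unitaryGroup_iff.1 hU) ?_ ?_ hu
  · rw [expPath_zero, hf, hy0]
  · rw [x.horVelocity_eq hV, velocity_expPath, expVelocity_zero, hv, hyv]
    rfl

theorem HorVec.isGrExp_iff (hV : IsTwistedLoopSpace V) (x : HorVec V)
    (Q : Submodule ℂ (ℝ → ℂ)) : IsGrExp V x.toGr Q ↔ Q = plane (expPath x.frame x.vec 1) := by
  constructor
  · rintro ⟨I, c, hI, hI', h01, hc, hc', rfl⟩
    exact x.eq_plane_expPath hV hI hI' (h01 ⟨le_rfl, zero_le_one⟩) hc hc' (h01 ⟨zero_le_one, le_rfl⟩)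
  · rintro rfl
    exact ⟨univ, _, isOpen_univ, ordConnected_univ, subset_univ _, x.isGrGeodesic hV,
      x.hasInitialVelocity hV, rfl⟩

/-- Existence of an exponential for each tangent vector, and its uniqueness, both follow from
`HorVec.isGrExp_iff`, which identifies it with the plane of the explicit path at time `1`. -/
theorem existsUnique_grExp (hV : IsTwistedLoopSpace V) :
    ∃! e : GrTangent V → grassmannian V, ∀ ξ, IsGrExp V ξ (e ξ) := by
  have hex : ∀ ξ : GrTangent V, ∃ Q : grassmannian V, IsGrExp V ξ Q := by
    intro ξ
    obtain ⟨x, rfl⟩ := Quotient.exists_rep ξ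
    exact ⟨⟨_, plane_mem_grassmannian hV ((x.isSmoothPath hV).2 1 (mem_univ 1))⟩,
      (x.isGrExp_iff hV _).2 rfl⟩
  choose e he using hex
  refine ⟨e, he, fun e' he' => funext fun ξ => Subtype.ext ?_⟩
  have h1 := he ξ
  have h2 := he' ξ
  obtain ⟨x, rfl⟩ := Quotient.exists_rep ξ
  exact ((x.isGrExp_iff hV _).1 h2).trans ((x.isGrExp_iff hV _).1 h1).symm

end GrassmannianGeodesics

/-! ### The geodesics of the Stiefel manifold -/

section StiefelGeodesics

variable {V : Submodule ℂ (ℝ → ℂ)} {I : Set ℝ} {Ψ : ℝ → Pair}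

theorem isGeodesic_expPath (hV : IsTwistedLoopSpace V) {Φ F : Pair} (hΦ : Φ ∈ stiefel V)
    (hF : F ∈ stiefelTangent V Φ) : IsGeodesic V univ (expPath Φ F) :=
  (isGeodesic_iff hV isOpen_univ (isSmoothPath_expPath hV hΦ hF)).2 fun u _ =>
    acceleration_expPath hV hΦ hF u

theorem IsGeodesic.eq_expPath (hV : IsTwistedLoopSpace V) (hI : IsOpen I) (hI' : I.OrdConnected)
    (h0 : (0 : ℝ) ∈ I) (h : IsGeodesic V I Ψ) {u : ℝ} (hu : u ∈ I) :
    Ψ u = expPath (Ψ 0) (velocity Ψ 0) u :=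
  h.1.eq_expPath hV hI hI' h0 ((isGeodesic_iff hV hI h.1).1 h) hu

/-- Geodesics stay in the span of their initial data, because the explicit path is a row of
combinations of these. -/
theorem IsGeodesic.mem_stiefel_span (hV : IsTwistedLoopSpace V) (hI : IsOpen I)
    (hI' : I.OrdConnected) (h0 : (0 : ℝ) ∈ I) (h : IsGeodesic V I Ψ) {W : Submodule ℂ (ℝ → ℂ)}
    (hW : W = Submodule.span ℂ (range (Ψ 0) ∪ range (velocity Ψ 0))) :
    W ≤ V ∧ FiniteDimensional ℂ W ∧ Module.finrank ℂ W ≤ 4 ∧ ∀ u ∈ I, Ψ u ∈ stiefel W := by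
  have hspan : W = Submodule.span ℂ (range (Sum.elim (Ψ 0) (velocity Ψ 0))) := by
    rw [hW, Sum.elim_range]
  have hmem : ∀ i, Ψ 0 i ∈ W := fun i => by
    rw [hW]
    exact Submodule.subset_span (Or.inl (mem_range_self i))
  have hmem' : ∀ i, velocity Ψ 0 i ∈ W := fun i => by
    rw [hW]
    exact Submodule.subset_span (Or.inr (mem_range_self i))
  refine ⟨?_, ?_, ?_, fun u hu => mem_stiefel_iff.2 ⟨?_, h.1.gram_self hu⟩⟩
  · rw [hW, Submodule.span_le]
    rintro _ (⟨i, rfl⟩ | ⟨i, rfl⟩)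
    · exact h.1.mem h0 i
    · exact (h.1.velocity_mem_stiefelTangent hV hI h0).1 i
  · rw [hspan]
    exact FiniteDimensional.span_of_finite ℂ (finite_range _)
  · rw [hspan]
    exact finrank_range_le_card _
  · rw [h.eq_expPath hV hI hI' h0 hu]
    exact expPath_mem hmem hmem' u

end StiefelGeodesics

end FramedLoop

end

theorem proposition6p1 (V : Submodule ℂ (ℝ → ℂ))
    (hV : V = FramedLoop.loopSpace ∨ V = FramedLoop.antiloopSpace) :
    -- the geodesic equation
    (∀ (I : Set ℝ) (Φ : ℝ → FramedLoop.Pair), IsOpen I → I.OrdConnected →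
      FramedLoop.IsSmoothPath V I Φ →
      (FramedLoop.IsGeodesic V I Φ ↔
        ∀ u ∈ I, FramedLoop.acceleration Φ u +
          FramedLoop.rmul (Φ u)
            (FramedLoop.adj (FramedLoop.velocity Φ u) (FramedLoop.velocity Φ u)) = 0)) ∧
    -- its solution with given initial data: existence for all times, and uniqueness
    (∀ Φ ∈ FramedLoop.stiefel V, ∀ F ∈ FramedLoop.stiefelTangent V Φ,
      FramedLoop.IsGeodesic V Set.univ (FramedLoop.expPath Φ F) ∧
      FramedLoop.expPath Φ F 0 = Φ ∧
      FramedLoop.velocity (FramedLoop.expPath Φ F) 0 = F ∧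
      ∀ (I : Set ℝ) (Ψ : ℝ → FramedLoop.Pair), IsOpen I → I.OrdConnected → (0 : ℝ) ∈ I →
        FramedLoop.IsGeodesic V I Ψ → Ψ 0 = Φ → FramedLoop.velocity Ψ 0 = F →
        ∀ u ∈ I, Ψ u = FramedLoop.expPath Φ F u) ∧
    -- geodesics stay in a finite-dimensional Stiefel manifold
    (∀ (I : Set ℝ) (Ψ : ℝ → FramedLoop.Pair), IsOpen I → I.OrdConnected → (0 : ℝ) ∈ I →
      FramedLoop.IsGeodesic V I Ψ →
      ∀ W : Submodule ℂ (ℝ → ℂ),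
        W = Submodule.span ℂ (Set.range (Ψ 0) ∪ Set.range (FramedLoop.velocity Ψ 0)) →
        W ≤ V ∧ FiniteDimensional ℂ W ∧ Module.finrank ℂ W ≤ 4 ∧
          ∀ u ∈ I, Ψ u ∈ FramedLoop.stiefel W) ∧
    -- horizontal geodesics stay horizontal, and project to the geodesics of the Grassmannian
    (∀ x : FramedLoop.HorVec V,
      (∀ u, FramedLoop.velocity (FramedLoop.expPath x.frame x.vec) u ∈
        FramedLoop.horizontal V (FramedLoop.expPath x.frame x.vec u)) ∧
      FramedLoop.IsGrGeodesic V Set.univ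
        (fun u => FramedLoop.plane (FramedLoop.expPath x.frame x.vec u)) ∧
      FramedLoop.HasInitialVelocity V Set.univ
        (fun u => FramedLoop.plane (FramedLoop.expPath x.frame x.vec u)) x.toGr ∧
      ∀ (I : Set ℝ) (c : ℝ → Submodule ℂ (ℝ → ℂ)), IsOpen I → I.OrdConnected → (0 : ℝ) ∈ I →
        FramedLoop.IsGrGeodesic V I c → FramedLoop.HasInitialVelocity V I c x.toGr →
        ∀ u ∈ I, c u = FramedLoop.plane (FramedLoop.expPath x.frame x.vec u)) ∧
    -- the exponential map of the Grassmannian is well defined on all tangent vectors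
    (∃! e : FramedLoop.GrTangent V → FramedLoop.grassmannian V,
      ∀ ξ, FramedLoop.IsGrExp V ξ (e ξ)) := by
  have hV' := FramedLoop.isTwistedLoopSpace_of_eq hV
  refine ⟨fun I Φ hI _ hΦ => FramedLoop.isGeodesic_iff hV' hI hΦ, fun Φ hΦ F hF => ⟨?_, ?_, ?_, ?_⟩,
    fun I Ψ hI hI' h0 hΨ W hW => hΨ.mem_stiefel_span hV' hI hI' h0 hW,
    fun x => ⟨x.velocity_mem_horizontal hV', x.isGrGeodesic hV', x.hasInitialVelocity hV',
      fun I c hI hI' h0 hc hc' u hu => x.eq_plane_expPath hV' hI hI' h0 hc hc' hu⟩,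
    FramedLoop.existsUnique_grExp hV'⟩
  · exact FramedLoop.isGeodesic_expPath hV' hΦ hF
  · exact FramedLoop.expPath_zero Φ F
  · rw [FramedLoop.velocity_expPath, FramedLoop.expVelocity_zero]
  · rintro I Ψ hI hI' h0 hΨ rfl rfl u hu
    exact hΨ.eq_expPath hV' hI hI' h0 hu
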